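/- Let $k$ be a local field of characteristic $0$, let $G$ be a linear algebraic group over $k$, let $H\subseteq G$ be an algebraic subgroup defined over $k$, let $N$ be a normal algebraic subgroup of $H$ defined over $k$, and let $\varphi\colon H\to Q=H/N$ be the quotient homomorphism. A one parameter algebraic unipotent subgroup of $G(k)$ is a subgroup of the form $U(k)$, where $U$ is a unipotent algebraic subgroup of $G$ defined over $k$ and of dimension at most one. For a subgroup $L$ of $G(k)$, let $L^+$ be the subgroup generated by the one parameter algebraic unipotent subgroups of $G(k)$ that are contained in $L$; in particular this defines $G(k)^+$. The same definitions apply to $H$ and to $Q$ in place of $G$. Then: 1. $H(k)^+\subseteq G(k)^+\cap H(k)$; 2. $Q(k)^+\subseteq\varphi\left(H(k)^+\right)$; 3. if $W$ is a subgroup of $H(k)$ that contains $N(k)$ and satisfies $W^+\subseteq N(k)$, then $\varphi(W)^+$ is the trivial subgroup of $Q(k)$. -/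

import Mathlib

/-!
Linear algebraic groups over a field `k` are represented by their coordinate rings: the affine
algebraic group `G` corresponds to the commutative Hopf algebra `A = k[G]`, finitely generated as
a `k`-algebra. A homomorphism `H → G` corresponds to a bialgebra homomorphism `k[G] → k[H]`, and
closed subgroups correspond to surjective bialgebra homomorphisms, or to Hopf ideals.
-/

universe u v

open scoped TensorProduct

namespace AlgGrp

noncomputable section

/-- The `R`-points `G(R) = Hom_k(k[G], R)` of the affine group `G` with coordinate ring `A`. The
convolution product of `WithConv` is the group law of `G(R)`. -/
abbrev Points (k : Type v) (A : Type u) (R : Type*) [CommSemiring k] [CommSemiring A]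
    [CommSemiring R] [Algebra k A] [Algebra k R] : Type _ :=
  WithConv (A →ₐ[k] R)

/-- The homomorphism `H(R) → G(R)`, `h ↦ h ∘ f`, induced by the homomorphism of groups `H → G`
which corresponds to the bialgebra homomorphism `f : k[G] → k[H]`. -/
def pointsMap {k : Type v} {A B : Type u} [Field k] [CommRing A] [CommRing B]
    [HopfAlgebra k A] [HopfAlgebra k B] (f : A →ₐc[k] B)
    (R : Type*) [CommRing R] [Algebra k R] : Points k B R →* Points k A R where
  toFun h := WithConv.toConv (h.ofConv.comp (f : A →ₐ[k] B))
  map_one' := by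
    apply WithConv.ext
    ext a
    simp [AlgHom.convOne_def]
  map_mul' g h := by
    apply WithConv.ext
    exact AlgHom.convMul_comp_bialgHom_distrib g h f

/-- The right translation operator `ρ_g : k[G] → k[G]`, `(ρ_g f)(x) = f (x g)`, for `g ∈ G(k)`. -/
def rightTranslation {k : Type v} {A : Type u} [Field k] [CommRing A] [HopfAlgebra k A]
    (g : Points k A k) : A →ₗ[k] A :=
  (TensorProduct.rid k A).toLinearMap ∘ₗ
    g.ofConv.toLinearMap.lTensor A ∘ₗ Coalgebra.comul

/-- An element `g ∈ G(k)` is unipotent if right translation by `g` on `k[G]` is locally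
unipotent. -/
def IsUnipotentElement {k : Type v} {A : Type u} [Field k] [CommRing A] [HopfAlgebra k A]
    (g : Points k A k) : Prop :=
  ∀ a : A, ∃ n : ℕ, ((rightTranslation g - 1) ^ n) a = 0

/-- The algebraic group with coordinate ring `A` is unipotent if every element of its group of
points over an algebraic closure `K` of `k` is unipotent. (The points over `K` are those of the
base change, whose coordinate ring is `K ⊗ A`.) -/
def IsUnipotentGroup (k : Type v) (A : Type u) [Field k] [CommRing A] [HopfAlgebra k A] : Prop :=
  ∀ g : Points (AlgebraicClosure k) (AlgebraicClosure k ⊗[k] A) (AlgebraicClosure k),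
    IsUnipotentElement g

/-- One parameter algebraic unipotent subgroups of `G(k)`: the subgroups of the form `U(k)`, for
`U` a unipotent algebraic subgroup of `G` defined over `k`, of dimension at most one. -/
def IsOneParamUnipotent {k : Type v} {A : Type u} [Field k] [CommRing A] [HopfAlgebra k A]
    (S : Subgroup (Points k A k)) : Prop :=
  ∃ (I : Ideal A) (_ : I.IsHopfIdeal k),
    IsUnipotentGroup k (A ⧸ I) ∧ ringKrullDim (A ⧸ I) ≤ 1 ∧
      S = (pointsMap (Bialgebra.Quotient.mkBialgHom (R := k) I) k).range

/-- For a subgroup `L` of `G(k)`, the subgroup `L⁺` generated by the one parameter algebraic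
unipotent subgroups of `G(k)` that are contained in `L`. -/
def plus {k : Type v} {A : Type u} [Field k] [CommRing A] [HopfAlgebra k A]
    (L : Subgroup (Points k A k)) : Subgroup (Points k A k) :=
  sSup {S | IsOneParamUnipotent S ∧ S ≤ L}

/-- The subgroup `G(k)⁺` of `G(k)`, for the algebraic group `G` with coordinate ring `A`. -/
abbrev plusPoints (k : Type v) (A : Type u) [Field k] [CommRing A] [HopfAlgebra k A] :
    Subgroup (Points k A k) :=
  plus ⊤

/-- The closed subgroup `N` of `H` given by `π : k[H] → k[N]` is normal: for every commutative
`k`-algebra `R`, one has `h N(R) ⊆ N(R) h` for all `h` in the group `H(R)`. -/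
def IsNormal {k : Type v} {B C : Type u} [Field k] [CommRing B] [CommRing C]
    [HopfAlgebra k B] [HopfAlgebra k C] (π : B →ₐc[k] C) : Prop :=
  ∀ (R : Type u) [CommRing R] [Algebra k R] (h : Points k B R) (n : Points k C R),
    ∃ n' : Points k C R, h * pointsMap π R n = pointsMap π R n' * h

/-- The homomorphism `H → Q` corresponding to `φ : k[Q] → k[H]` is a quotient homomorphism with
kernel the subgroup `N` of `H` given by `π : k[H] → k[N]`; that is, `Q = H / N`.

A homomorphism of affine groups over a field is a quotient homomorphism (equivalently, faithfully
flat; equivalently for algebraic groups in characteristic zero, surjective over an algebraic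
closure) when it is injective on coordinate rings. Its kernel, the fibre over the neutral element,
is defined in `H` by the ideal generated by the augmentation ideal of `k[Q]`. -/
structure IsQuotientBy {k : Type v} {B C D : Type u} [Field k] [CommRing B] [CommRing C]
    [CommRing D] [HopfAlgebra k B] [HopfAlgebra k C] [HopfAlgebra k D]
    (φ : D →ₐc[k] B) (π : B →ₐc[k] C) : Prop where
  injective : Function.Injective φ
  ker_eq : RingHom.ker π =
    Ideal.map φ (RingHom.ker (Bialgebra.counitAlgHom k D))

end

end AlgGrp

/-!
In characteristic zero a unipotent element `g` of `G(k)` has a polynomial orbit `j ↦ g ^ j`, and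
interpolating it gives a homomorphism from the additive group to `G`, that is, a bialgebra
homomorphism `k[G] → k[X]`. Hence `L⁺` is generated by the values at `1` of the homomorphisms from
the additive group whose image lies in `L`. This description is visibly functorial, which gives the
first inclusion.

The point is to lift a homomorphism from the additive group along the quotient `H → Q`. Its velocity
is a tangent vector of `Q` at the identity; it lifts to a tangent vector of `H`, since in
characteristic zero a `k`-valued derivation extends from `k[Q]` to `k[H]`. The left invariant vector
field of the lift is a locally finite operator on `k[H]`, but it need not be locally nilpotent.
Its Jordan nilpotent part is again a left invariant derivation, and restricts to the same operator
on `k[Q]`, where the vector field was already nilpotent. Exponentiating the nilpotent part gives the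
required lift.

As the kernel of `H(k) → Q(k)` is `N(k)`, the preimage in `H(k)` of `φ(W)` is `W`, and the third
claim follows by applying the lifting to `φ(W)⁺`.
-/

namespace AlgGrp

section LeftInvariant

open Coalgebra

variable {k A : Type*} [CommRing k] [AddCommGroup A] [Module k A] [Coalgebra k A]

/-- The left invariant operator `a ↦ ∑ f(a₂) a₁` on `k[G]` given by a linear form `f`: differential
operators at the neutral element correspond in this way to left invariant differential operators,
and evaluation at `g ∈ G(k)` to the right translation by `g`. -/
noncomputable def leftInvariantOp (f : A →ₗ[k] k) : A →ₗ[k] A :=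
  (TensorProduct.rid k A).toLinearMap ∘ₗ f.lTensor A ∘ₗ comul

theorem leftInvariantOp_apply (f : A →ₗ[k] k) {a : A} {κ : Type*} (r : Coalgebra.Repr k a κ) :
    leftInvariantOp f a = ∑ i ∈ r.index, f (r.right i) • r.left i := by
  simp [leftInvariantOp, ← r.eq]

theorem counit_leftInvariantOp (f : A →ₗ[k] k) (a : A) :
    counit (R := k) (leftInvariantOp f a) = f a := by
  conv_rhs => rw [← sum_counit_smul (ℛ k a)]
  rw [leftInvariantOp_apply f (ℛ k a)]
  simp [mul_comm]

theorem comul_comp_leftInvariantOp (f : A →ₗ[k] k) :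
    comul ∘ₗ leftInvariantOp f = (leftInvariantOp f).lTensor A ∘ₗ comul := by
  have comul_contract : comul ∘ₗ (TensorProduct.rid k A).toLinearMap ∘ₗ f.lTensor A =
      (TensorProduct.rid k (A ⊗[k] A)).toLinearMap ∘ₗ f.lTensor (A ⊗[k] A) ∘ₗ
        (comul (R := k) (A := A)).rTensor A := by
    ext; simp
  have contract_assoc : (TensorProduct.rid k (A ⊗[k] A)).toLinearMap ∘ₗ
      f.lTensor (A ⊗[k] A) ∘ₗ (TensorProduct.assoc k A A A).symm.toLinearMap =
      ((TensorProduct.rid k A).toLinearMap ∘ₗ f.lTensor A).lTensor A := by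
    ext; simp
  ext a
  have coassoc := (TensorProduct.assoc k A A A).eq_symm_apply.2 (coassoc_apply (R := k) a)
  calc comul (leftInvariantOp f a)
      = TensorProduct.rid k (A ⊗[k] A) (f.lTensor (A ⊗[k] A) (comul.rTensor A (comul a))) :=
        congr($comul_contract (comul a))
    _ = ((TensorProduct.rid k A).toLinearMap ∘ₗ f.lTensor A).lTensor A
          (comul.lTensor A (comul a)) := by
        rw [coassoc]
        exact congr($contract_assoc (comul.lTensor A (comul a)))
    _ = (leftInvariantOp f).lTensor A (comul a) := by
        rw [← LinearMap.comp_apply, ← LinearMap.lTensor_comp]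
        rfl

theorem eq_leftInvariantOp_of_comul_comp {T : A →ₗ[k] A}
    (hT : comul ∘ₗ T = T.lTensor A ∘ₗ comul) : T = leftInvariantOp (counit ∘ₗ T) := by
  ext a
  have h := congr(TensorProduct.rid k A ((counit (R := k)).lTensor A ($hT a)))
  simpa [leftInvariantOp, LinearMap.lTensor_comp] using h

theorem leftInvariantOp_counit : leftInvariantOp (counit (R := k) (A := A)) = LinearMap.id := by
  have h : comul ∘ₗ LinearMap.id = (LinearMap.id (R := k) (M := A)).lTensor A ∘ₗ comul := by
    rw [LinearMap.lTensor_id, LinearMap.comp_id, LinearMap.id_comp]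
  exact (eq_leftInvariantOp_of_comul_comp h).symm

theorem comul_comp_pow {T : Module.End k A} (hT : comul ∘ₗ T = T.lTensor A ∘ₗ comul) (n : ℕ) :
    comul ∘ₗ (T ^ n) = (T ^ n).lTensor A ∘ₗ comul := by
  induction n with
  | zero =>
    rw [pow_zero, Module.End.one_eq_id, LinearMap.lTensor_id, LinearMap.comp_id, LinearMap.id_comp]
  | succ n ih =>
    rw [pow_succ', Module.End.mul_eq_comp, LinearMap.lTensor_comp, LinearMap.comp_assoc, ← ih,
      ← LinearMap.comp_assoc, hT, LinearMap.comp_assoc]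

theorem leftInvariantOp_convMul (f g : WithConv (A →ₗ[k] k)) :
    leftInvariantOp (f * g).ofConv = leftInvariantOp f.ofConv ∘ₗ leftInvariantOp g.ofConv := by
  have h : comul ∘ₗ (leftInvariantOp f.ofConv ∘ₗ leftInvariantOp g.ofConv) =
      (leftInvariantOp f.ofConv ∘ₗ leftInvariantOp g.ofConv).lTensor A ∘ₗ comul := by
    rw [← LinearMap.comp_assoc, comul_comp_leftInvariantOp, LinearMap.comp_assoc,
      comul_comp_leftInvariantOp, LinearMap.lTensor_comp, LinearMap.comp_assoc]
  rw [eq_leftInvariantOp_of_comul_comp h]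
  congr 1
  ext a
  rw [(ℛ k a).convMul_apply]
  simp [counit_leftInvariantOp, leftInvariantOp_apply _ (ℛ k a), mul_comm]

theorem coalgHom_leftInvariantOp {B F : Type*} [AddCommGroup B] [Module k B] [Coalgebra k B]
    [FunLike F A B] [CoalgHomClass F k A B] (φ : F) (f : B →ₗ[k] k) (a : A) :
    φ (leftInvariantOp (f ∘ₗ (φ : A →ₗ[k] B)) a) = leftInvariantOp f (φ a) := by
  have h : comul (R := k) (φ a) = TensorProduct.map (φ : A →ₗ[k] B) (φ : A →ₗ[k] B) (comul a) :=
    (CoalgHomClass.map_comp_comul_apply φ a).symm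
  simp [leftInvariantOp, h, ← (ℛ k a).eq]

end LeftInvariant

section BialgHom

open WithConv

theorem bialgHom_antipode {k A B : Type*} [CommRing k] [CommRing A] [HopfAlgebra k A] [CommRing B]
    [HopfAlgebra k B] (f : A →ₐc[k] B) (a : A) :
    f (HopfAlgebraStruct.antipode k a) = HopfAlgebraStruct.antipode k (f a) := by
  let F : WithConv (A →ₐ[k] B) := toConv f
  have hright : F * toConv ((toConv (AlgHom.id k B))⁻¹.ofConv.comp (f : A →ₐ[k] B)) = 1 := by
    apply WithConv.ext
    have := AlgHom.convMul_comp_bialgHom_distrib (toConv (AlgHom.id k B))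
      (toConv (AlgHom.id k B))⁻¹ f
    rw [mul_inv_cancel] at this
    refine this.symm.trans ?_
    ext a
    simp [AlgHom.convOne_def]
  exact congr(($(inv_eq_of_mul_eq_one_right hright)).ofConv a)

theorem map_mkQ_eq_zero_of_map_eq_zero {k V M : Type*} [Field k] [AddCommGroup V] [Module k V]
    [AddCommGroup M] [Module k M] (f : V →ₗ[k] M) {z : V ⊗[k] V}
    (hz : TensorProduct.map f f z = 0) :
    TensorProduct.map (LinearMap.ker f).mkQ (LinearMap.ker f).mkQ z = 0 := by
  let q := (LinearMap.ker f).liftQ f le_rfl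
  have hq : Function.Injective q :=
    LinearMap.ker_eq_bot.1 (Submodule.ker_liftQ_eq_bot _ _ _ le_rfl)
  have hf : TensorProduct.map f f = TensorProduct.map q q ∘ₗ
      TensorProduct.map (LinearMap.ker f).mkQ (LinearMap.ker f).mkQ := by
    rw [← TensorProduct.map_comp]
    rfl
  rw [hf, LinearMap.comp_apply] at hz
  exact TensorProduct.map_injective_of_flat_flat q q hq hq (hz.trans (map_zero _).symm)

theorem isHopfIdeal_ker {k A B : Type*} [Field k] [CommRing A] [HopfAlgebra k A] [CommRing B]
    [HopfAlgebra k B] (f : A →ₐc[k] B) : (RingHom.ker f).IsHopfIdeal k where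
  counit_eq_zero x hx := by
    have hx : f x = 0 := hx
    rw [← CoalgHomClass.counit_comp_apply f x, hx, map_zero]
  map_mkQ_comul_eq_zero x hx := by
    have hx : f x = 0 := hx
    refine map_mkQ_eq_zero_of_map_eq_zero (f : A →ₗ[k] B) ?_
    exact (CoalgHomClass.map_comp_comul_apply f x).trans (by rw [hx, map_zero])
  antipode_mem x hx := by
    have hx : f x = 0 := hx
    rw [RingHom.mem_ker, bialgHom_antipode, hx, map_zero]

end BialgHom

section Points

open Coalgebra WithConv

variable {k A R : Type*} [CommRing k] [CommRing A] [Bialgebra k A] [CommRing R] [Algebra k R]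

theorem Points.mul_apply (g h : Points k A R) {a : A} {κ : Type*} (r : Coalgebra.Repr k a κ) :
    (g * h).ofConv a = ∑ i ∈ r.index, g.ofConv (r.left i) * h.ofConv (r.right i) := by
  have := AlgHom.convMul_apply g h a
  rw [← r.eq] at this
  simpa using this

theorem Points.one_apply (a : A) :
    (1 : Points k A R).ofConv a = algebraMap k R (counit a) := rfl

/-- The homomorphism `G(R) → G(S)` induced by a homomorphism `R → S`. -/
def Points.mapCoeff {S : Type*} [CommRing S] [Algebra k S] (e : R →ₐ[k] S) :
    Points k A R →* Points k A S where
  toFun g := toConv (e.comp g.ofConv)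
  map_one' := by
    apply WithConv.ext
    ext a
    simp [AlgHom.convOne_def]
  map_mul' g h := by
    apply WithConv.ext
    exact AlgHom.comp_convMul_distrib e g h

/-- The identification of the `K`-points of the base change of `G` to `K` with `G(K)`. -/
noncomputable def Points.ofBaseChange (K : Type*) [Field K] [Algebra k K] :
    Points K (K ⊗[k] A) K →* Points k A K where
  toFun g := toConv ((g.ofConv.restrictScalars k).comp Algebra.TensorProduct.includeRight)
  map_one' := by
    apply WithConv.ext
    ext a
    simp [AlgHom.convOne_def]
  map_mul' g h := by
    apply WithConv.ext
    ext a
    rw [Points.mul_apply _ _ (ℛ k a)]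
    refine (AlgHom.convMul_apply g h (1 ⊗ₜ[k] a)).trans ?_
    rw [TensorProduct.comul_tmul, ← (ℛ k a).eq]
    simp [TensorProduct.tmul_sum]

theorem Points.ofBaseChange_apply {K : Type*} [Field K] [Algebra k K]
    (g : Points K (K ⊗[k] A) K) (a : A) :
    (Points.ofBaseChange K g).ofConv a = g.ofConv (1 ⊗ₜ a) := rfl

theorem Points.ofBaseChange_surjective {K : Type*} [Field K] [Algebra k K] :
    Function.Surjective (Points.ofBaseChange K : Points K (K ⊗[k] A) K → Points k A K) := by
  intro g
  refine ⟨toConv (Algebra.TensorProduct.lift (Algebra.ofId K K) g.ofConv fun _ _ ↦ .all _ _), ?_⟩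
  apply WithConv.ext
  ext a
  rw [Points.ofBaseChange_apply]
  simp

end Points

section PointsMap

variable {k : Type*} {A B : Type u} [Field k] [CommRing A] [HopfAlgebra k A] [CommRing B]
  [HopfAlgebra k B] {R : Type*} [CommRing R] [Algebra k R]

theorem pointsMap_apply (f : A →ₐc[k] B) (g : Points k B R) (a : A) :
    (pointsMap f R g).ofConv a = g.ofConv (f a) := rfl

theorem exists_pointsMap_eq_iff {f : A →ₐc[k] B} (hf : Function.Surjective f)
    {g : Points k A R} : (∃ h, pointsMap f R h = g) ↔ ∀ a, f a = 0 → g.ofConv a = 0 := by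
  refine ⟨?_, fun hg ↦ ?_⟩
  · rintro ⟨h, rfl⟩ a ha
    rw [pointsMap_apply, ha, map_zero]
  · refine ⟨WithConv.toConv ((f : A →ₐ[k] B).liftOfSurjective hf g.ofConv hg), ?_⟩
    apply WithConv.ext
    ext a
    exact AlgHom.liftOfSurjective_apply (f : A →ₐ[k] B) hf g.ofConv hg a

end PointsMap

section AdditiveGroup

open Coalgebra WithConv Polynomial

variable {k : Type*} [CommRing k]

/-- The coordinate ring `k[X]` of the additive group: the indeterminate `X` is primitive. A
homomorphism from the additive group to `G` is thus a bialgebra homomorphism `k[G] → k[X]`. -/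
noncomputable scoped instance additiveBialgebra : Bialgebra k k[X] :=
  .ofAlgHom (aeval (X ⊗ₜ 1 + 1 ⊗ₜ X)) (aeval 0)
    (by
      ext
      simp [Algebra.TensorProduct.one_def, TensorProduct.add_tmul, TensorProduct.tmul_add,
        add_assoc])
    (by ext; simp)
    (by ext; simp)

theorem comul_polynomial (P : k[X]) :
    comul (R := k) P = aeval (X ⊗ₜ[k] 1 + 1 ⊗ₜ[k] X : k[X] ⊗[k] k[X]) P := rfl

theorem counit_polynomial (P : k[X]) : counit (R := k) P = P.eval 0 := by
  rw [← coe_aeval_eq_eval]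
  rfl

noncomputable scoped instance additiveHopfAlgebra : HopfAlgebra k k[X] :=
  .ofAlgHom (aeval (-X))
    (algHom_ext <| by
      simp only [AlgHom.comp_apply, Bialgebra.comulAlgHom_apply, comul_polynomial, aeval_X, map_add]
      refine (congrArg₂ (· + ·) (Algebra.TensorProduct.lift_tmul ..)
        (Algebra.TensorProduct.lift_tmul ..)).trans ?_
      simp [counit_polynomial])
    (algHom_ext <| by simp [comul_polynomial, counit_polynomial])

variable {R : Type*} [CommRing R] [Algebra k R]

theorem aeval_convMul (s t : R) :
    (toConv (aeval s) * toConv (aeval t) : WithConv (k[X] →ₐ[k] R)) = toConv (aeval (s + t)) := by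
  apply WithConv.ext
  ext
  rw [AlgHom.convMul_apply, comul_polynomial]
  simp

theorem aeval_zero_eq_one : toConv (aeval (0 : R)) = (1 : WithConv (k[X] →ₐ[k] R)) := by
  apply WithConv.ext
  ext
  simp [AlgHom.convOne_def, counit_polynomial]

end AdditiveGroup

section EvalPoint

open WithConv Polynomial

variable {k A R : Type*} [CommRing k] [CommRing A] [Bialgebra k A] [CommRing R] [Algebra k R]
  (lam : A →ₐc[k] k[X])

/-- The value in `G(R)` at `t ∈ R` of a homomorphism from the additive group to `G`. -/
noncomputable def evalPoint (t : R) : Points k A R :=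
  toConv ((aeval t).comp (lam : A →ₐ[k] k[X]))

theorem evalPoint_apply (t : R) (a : A) : (evalPoint lam t).ofConv a = aeval t (lam a) := rfl

theorem evalPoint_add (s t : R) : evalPoint lam (s + t) = evalPoint lam s * evalPoint lam t := by
  apply WithConv.ext
  have := AlgHom.convMul_comp_bialgHom_distrib (toConv (aeval s)) (toConv (aeval t)) lam
  rwa [aeval_convMul] at this

theorem evalPoint_zero : evalPoint lam (0 : R) = 1 := by
  apply WithConv.ext
  ext a
  change (toConv (aeval (0 : R))).ofConv (lam a) = _
  rw [aeval_zero_eq_one]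
  simp [AlgHom.convOne_def]

theorem evalPoint_nsmul (t : R) (j : ℕ) : evalPoint lam (j • t) = evalPoint lam t ^ j := by
  induction j with
  | zero => rw [zero_nsmul, pow_zero, evalPoint_zero]
  | succ j ih => rw [succ_nsmul, pow_succ, evalPoint_add, ih]

end EvalPoint

section Separating

theorem tensor_eq_zero_of_separating {k M N ι κ : Type*} [Field k] [AddCommGroup M] [Module k M]
    [AddCommGroup N] [Module k N] {f : ι → M →ₗ[k] k} {g : κ → N →ₗ[k] k}
    (hf : ∀ m, (∀ i, f i m = 0) → m = 0) (hg : ∀ n, (∀ j, g j n = 0) → n = 0) {z : M ⊗[k] N}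
    (hz : ∀ i j, LinearMap.mul' k k (TensorProduct.map (f i) (g j) z) = 0) : z = 0 := by
  classical
  let b := Module.Basis.ofVectorSpace k N
  have slice (i j) : g j ∘ₗ (TensorProduct.lid k N).toLinearMap ∘ₗ (f i).rTensor N =
      LinearMap.mul' k k ∘ₗ TensorProduct.map (f i) (g j) := by
    ext; simp
  have slice_eq_zero (i) : TensorProduct.lid k N ((f i).rTensor N z) = 0 :=
    hg _ fun j ↦ congr($(slice i j) z).trans (hz i j)
  have coordinate (i l) : f i ∘ₗ Finsupp.lapply l ∘ₗ
      (TensorProduct.equivFinsuppOfBasisRight b).toLinearMap =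
      b.coord l ∘ₗ (TensorProduct.lid k N).toLinearMap ∘ₗ (f i).rTensor N := by
    ext; simp [mul_comm]
  refine (TensorProduct.equivFinsuppOfBasisRight b).map_eq_zero_iff.1 (Finsupp.ext fun l ↦ ?_)
  refine hf _ fun i ↦ congr($(coordinate i l) z).trans ?_
  simp [slice_eq_zero]

end Separating

section PolynomialSequence

open Polynomial

theorem fwdDiff_iter_pow_apply {R M N : Type*} [Ring R] [AddCommGroup M] [Module R M]
    [AddCommGroup N] [Module R N] (ρ : Module.End R M) (f : M →ₗ[R] N) (a : M) (i : ℕ) :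
    (fwdDiff 1)^[i] (fun j : ℕ ↦ f ((ρ ^ j) a)) = fun j ↦ f ((ρ ^ j) (((ρ - 1) ^ i) a)) := by
  induction i with
  | zero => simp
  | succ i ih =>
    rw [Function.iterate_succ_apply', ih]
    ext j
    simp [fwdDiff, pow_succ, pow_succ' (ρ - 1), Module.End.mul_apply]

theorem exists_polynomial_of_fwdDiff_iter_eq_zero {F : Type*} [Field F] [CharZero F] {f : ℕ → F}
    {n : ℕ} (hf : ∀ i, n ≤ i → (fwdDiff 1)^[i] f 0 = 0) :
    ∃ P : F[X], ∀ j : ℕ, f j = P.eval (j : F) := by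
  refine ⟨∑ i ∈ Finset.range n, C (((fwdDiff 1)^[i] f 0) / i.factorial) * descPochhammer F i,
    fun j ↦ ?_⟩
  have newton : f j = ∑ i ∈ Finset.range (j + 1), j.choose i • (fwdDiff 1)^[i] f 0 := by
    simpa using shift_eq_sum_fwdDiff_iter 1 f j 0
  rw [newton, eval_finsetSum]
  refine Finset.sum_congr_of_eq_on_inter (fun i _ hi ↦ ?_) (fun i _ hi ↦ ?_) fun i _ _ ↦ ?_
  · rw [hf i (by simpa using hi), smul_zero]
  · rw [eval_mul, descPochhammer_eval_eq_descFactorial,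
      Nat.descFactorial_of_lt (by simpa using hi), Nat.cast_zero, mul_zero]
  · have : (i.factorial : F) ≠ 0 := Nat.cast_ne_zero.2 i.factorial_ne_zero
    rw [eval_mul, eval_C, descPochhammer_eval_eq_descFactorial,
      Nat.descFactorial_eq_factorial_mul_choose, nsmul_eq_mul, Nat.cast_mul]
    field_simp

theorem exists_sub_one_pow_apply_eq_zero {R A : Type*} [CommRing R] [CommRing A] [Algebra R A]
    (ρ : Module.End R A) {a : A} {Q : A[X]} (hQ : ∀ j : ℕ, (ρ ^ j) a = Q.eval (j : A)) :
    ∃ n : ℕ, ((ρ - 1) ^ n) a = 0 := by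
  refine ⟨Q.natDegree + 1, ?_⟩
  have hρ := congr_fun (fwdDiff_iter_pow_apply ρ LinearMap.id a (Q.natDegree + 1)) 0
  have hdeg := congr_fun Q.fwdDiff_iter_degree_add_one_eq_zero 0
  rw [fwdDiff_iter_eq_sum_shift] at hρ hdeg
  simp only [hQ, LinearMap.id_apply, zero_add, nsmul_eq_mul, mul_one, Nat.cast_id, pow_zero,
    Module.End.one_apply, Pi.zero_apply] at hρ hdeg
  exact hρ.symm.trans hdeg

theorem polynomial_eq_of_eval_natCast_eq {F : Type*} [Field F] [CharZero F] {P Q : F[X]}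
    (h : ∀ j : ℕ, P.eval (j : F) = Q.eval (j : F)) : P = Q := by
  refine Polynomial.eq_of_infinite_eval_eq P Q ((Set.infinite_range_of_injective
    (Nat.cast_injective (R := F))).mono ?_)
  rintro _ ⟨j, rfl⟩
  exact h j

theorem exists_polynomial_of_algebraMap_eq_eval {F K : Type*} [Field F] [Field K] [Algebra F K]
    {f : ℕ → F} {P : K[X]} (hP : ∀ j : ℕ, algebraMap F K (f j) = P.eval (j : K)) :
    ∃ Q : F[X], ∀ j : ℕ, f j = Q.eval (j : F) := by
  obtain ⟨r, hr⟩ := (Algebra.linearMap F K).exists_leftInverse_of_injective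
    (LinearMap.ker_eq_bot.2 (algebraMap F K).injective)
  refine ⟨∑ i ∈ P.support, C (r (P.coeff i)) * X ^ i, fun j ↦ ?_⟩
  have retract : r (algebraMap F K (f j)) = f j := congr($hr (f j))
  rw [← retract, hP, eval_eq_sum, sum_def, map_sum, eval_finsetSum]
  refine Finset.sum_congr rfl fun i _ ↦ ?_
  have : P.coeff i * (j : K) ^ i = (j : F) ^ i • P.coeff i := by
    rw [Algebra.smul_def, map_pow, map_natCast, mul_comm]
  rw [this, map_smul, eval_mul, eval_C, eval_pow, eval_X, smul_eq_mul, mul_comm]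

end PolynomialSequence

section Unipotent

open Coalgebra WithConv Polynomial

section

variable {k A R : Type*} [CommRing k] [CommRing A] [Bialgebra k A] [CommRing R] [Algebra k R]

/-- Every regular function takes the values of a polynomial function of `j` at the powers `gʲ`. In
characteristic zero this characterizes the unipotent elements. -/
def HasPolynomialPowers (g : Points k A R) : Prop :=
  ∀ a : A, ∃ P : R[X], ∀ j : ℕ, (g ^ j).ofConv a = P.eval (j : R)

theorem hasPolynomialPowers_evalPoint (lam : A →ₐc[k] k[X]) (t : R) :
    HasPolynomialPowers (evalPoint lam t) := by
  intro a
  refine ⟨((lam a).map (algebraMap k R)).comp (C t * X), fun j ↦ ?_⟩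
  rw [← evalPoint_nsmul, evalPoint_apply, eval_comp, eval_map_algebraMap, eval_mul, eval_C, eval_X,
    nsmul_eq_mul, mul_comm]

theorem hasPolynomialPowers_ofBaseChange {K : Type*} [Field K] [Algebra k K]
    {g : Points K (K ⊗[k] A) K} :
    HasPolynomialPowers (Points.ofBaseChange K g) ↔ HasPolynomialPowers g := by
  refine ⟨fun h x ↦ ?_, fun h a ↦ ?_⟩
  · induction x with
    | zero => exact ⟨0, fun j ↦ by simp⟩
    | add x y hx hy =>
      obtain ⟨P, hP⟩ := hx
      obtain ⟨Q, hQ⟩ := hy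
      exact ⟨P + Q, fun j ↦ by rw [map_add, hP, hQ, eval_add]⟩
    | tmul c a =>
      obtain ⟨P, hP⟩ := h a
      refine ⟨C c * P, fun j ↦ ?_⟩
      rw [eval_mul, eval_C, ← hP, ← map_pow, Points.ofBaseChange_apply, ← smul_eq_mul, ← map_smul,
        TensorProduct.smul_tmul', smul_eq_mul, mul_one]
  · obtain ⟨P, hP⟩ := h (1 ⊗ₜ a)
    exact ⟨P, fun j ↦ by rw [← hP, ← map_pow, Points.ofBaseChange_apply]⟩

end

variable {k A : Type*} [Field k] [CommRing A] [HopfAlgebra k A]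

theorem rightTranslation_pow (g : Points k A k) (j : ℕ) :
    rightTranslation g ^ j = leftInvariantOp (g ^ j).ofConv.toLinearMap := by
  induction j with
  | zero =>
    rw [pow_zero, pow_zero]
    exact leftInvariantOp_counit.symm
  | succ j ih =>
    rw [pow_succ, pow_succ, ih]
    exact (leftInvariantOp_convMul (toConv (g ^ j).ofConv.toLinearMap)
      (toConv g.ofConv.toLinearMap)).symm

theorem counit_rightTranslation_pow (g : Points k A k) (j : ℕ) (a : A) :
    counit (R := k) ((rightTranslation g ^ j) a) = (g ^ j).ofConv a := by
  rw [rightTranslation_pow, counit_leftInvariantOp]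
  rfl

theorem isUnipotentElement_iff [CharZero k] (g : Points k A k) :
    IsUnipotentElement g ↔ HasPolynomialPowers g := by
  refine ⟨fun h a ↦ ?_, fun h a ↦ ?_⟩
  · obtain ⟨n, hn⟩ := h a
    simp_rw [← counit_rightTranslation_pow]
    refine exists_polynomial_of_fwdDiff_iter_eq_zero (n := n) fun i hi ↦ ?_
    have hi : ((rightTranslation g - 1) ^ i) a = 0 := by
      rw [← Nat.sub_add_cancel hi, pow_add, Module.End.mul_apply, hn, map_zero]
    simp only [fwdDiff_iter_pow_apply, hi, map_zero]
  · choose P hP using h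
    let r := ℛ k a
    refine exists_sub_one_pow_apply_eq_zero (rightTranslation g)
      (Q := ∑ i ∈ r.index, (P (r.right i)).map (algebraMap k A) * C (r.left i)) fun j ↦ ?_
    rw [rightTranslation_pow, leftInvariantOp_apply _ r, eval_finsetSum]
    refine Finset.sum_congr rfl fun i _ ↦ ?_
    rw [eval_mul, eval_C, ← map_natCast (algebraMap k A) j, eval_map_apply, ← hP,
      Algebra.smul_def]
    rfl

theorem isUnipotentGroup_iff [CharZero k] :
    IsUnipotentGroup k A ↔ ∀ g : Points k A (AlgebraicClosure k), HasPolynomialPowers g := by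
  have : CharZero (AlgebraicClosure k) :=
    charZero_of_injective_algebraMap (algebraMap k (AlgebraicClosure k)).injective
  rw [Points.ofBaseChange_surjective.forall]
  exact forall_congr' fun g ↦
    (isUnipotentElement_iff g).trans hasPolynomialPowers_ofBaseChange.symm

theorem HasPolynomialPowers.of_mapCoeff {K : Type*} [Field K] [Algebra k K] {g : Points k A k}
    (hg : HasPolynomialPowers (Points.mapCoeff (Algebra.ofId k K) g)) :
    HasPolynomialPowers g := by
  intro a
  obtain ⟨P, hP⟩ := hg a
  simp_rw [← map_pow] at hP
  exact exists_polynomial_of_algebraMap_eq_eval hP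

theorem HasPolynomialPowers.of_pointsMap {A B : Type u} [CommRing A] [HopfAlgebra k A]
    [CommRing B] [HopfAlgebra k B] {R : Type*} [CommRing R] [Algebra k R]
    {f : A →ₐc[k] B} (hf : Function.Surjective f)
    {h : Points k B R} (hh : HasPolynomialPowers (pointsMap f R h)) : HasPolynomialPowers h := by
  intro b
  obtain ⟨a, rfl⟩ := hf b
  obtain ⟨P, hP⟩ := hh a
  exact ⟨P, fun j ↦ by rw [← hP, ← map_pow, pointsMap_apply]⟩

end Unipotent

section TangentVector

open Coalgebra

variable {k A : Type*} [CommRing k] [CommRing A] [Bialgebra k A]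

/-- The tangent vectors of `G` at the neutral element, as point derivations `k[G] → k`. -/
def IsTangentVector (f : A →ₗ[k] k) : Prop :=
  ∀ a b, f (a * b) = counit (R := k) a * f b + counit (R := k) b * f a

theorem IsTangentVector.comp_bialgHom {B : Type*} [CommRing B] [Bialgebra k B] {f : B →ₗ[k] k}
    (hf : IsTangentVector f) (φ : A →ₐc[k] B) : IsTangentVector (f ∘ₗ (φ : A →ₗ[k] B)) := by
  intro a b
  have h (c) : counit (R := k) (φ c) = counit c := CoalgHomClass.counit_comp_apply φ c
  simpa [h] using hf (φ a) (φ b)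

theorem IsTangentVector.leftInvariantOp_mul {f : A →ₗ[k] k} (hf : IsTangentVector f) (a b : A) :
    leftInvariantOp f (a * b) = a • leftInvariantOp f b + b • leftInvariantOp f a := by
  have leibniz (z w : A ⊗[k] A) : TensorProduct.rid k A (f.lTensor A (z * w)) =
      TensorProduct.rid k A ((counit (R := k)).lTensor A z) *
          TensorProduct.rid k A (f.lTensor A w) +
        TensorProduct.rid k A ((counit (R := k)).lTensor A w) *
          TensorProduct.rid k A (f.lTensor A z) := by
    induction z with
    | zero => simp
    | add z z' hz hz' => rw [add_mul, map_add, map_add, hz, hz']; simp only [map_add]; ring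
    | tmul a a' =>
      induction w with
      | zero => simp
      | add w w' hw hw' => rw [mul_add, map_add, map_add, hw, hw']; simp only [map_add]; ring
      | tmul b b' =>
        simp only [Algebra.TensorProduct.tmul_mul_tmul, LinearMap.lTensor_tmul,
          TensorProduct.rid_tmul, hf a' b', add_smul, smul_mul_smul_comm, mul_comm b a]
  have h := leibniz (comul a) (comul b)
  rw [← Bialgebra.comul_mul] at h
  simpa [leftInvariantOp] using h

/-- The left invariant vector field on `G` with a given value at the neutral element. -/
noncomputable def leftInvariantDerivation {f : A →ₗ[k] k} (hf : IsTangentVector f) :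
    Derivation k A A :=
  .mk' (leftInvariantOp f) hf.leftInvariantOp_mul

end TangentVector

section OneParameter

open Coalgebra WithConv Polynomial

theorem eval_comul_polynomial {k : Type*} [CommRing k] (s t : k) (P : k[X]) :
    LinearMap.mul' k k (TensorProduct.map (leval s) (leval t) (comul (R := k) P)) =
      P.eval (s + t) := by
  have h := AlgHom.convMul_apply (toConv (aeval s)) (toConv (aeval t)) P
  rw [aeval_convMul] at h
  rw [← coe_aeval_eq_eval]
  refine Eq.trans ?_ h.symm
  generalize (comul (R := k) P) = z
  induction z with
  | zero => simp
  | add z w hz hw => simp only [map_add, hz, hw]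
  | tmul P Q => simp [coe_aeval_eq_eval]

theorem exists_evalPoint_natCast_eq_pow {k A : Type*} [Field k] [CharZero k] [CommRing A]
    [Bialgebra k A] {g : Points k A k}
    (hg : HasPolynomialPowers g) :
    ∃ lam : A →ₐc[k] k[X], ∀ j : ℕ, evalPoint lam (j : k) = g ^ j := by
  choose P hP using hg
  let F : A →ₐ[k] k[X] := AlgHom.ofLinearMap
    ⟨⟨P, fun a b ↦ polynomial_eq_of_eval_natCast_eq fun j ↦ by simp [← hP]⟩,
      fun c a ↦ polynomial_eq_of_eval_natCast_eq fun j ↦ by simp [← hP]⟩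
    (polynomial_eq_of_eval_natCast_eq fun j ↦ by simp [← hP])
    fun a b ↦ polynomial_eq_of_eval_natCast_eq fun j ↦ by simp [← hP]
  have hF (j : ℕ) (a : A) : (F a).eval (j : k) = (g ^ j).ofConv a := (hP a j).symm
  have counit_comp : (Bialgebra.counitAlgHom k k[X]).comp F = Bialgebra.counitAlgHom k A := by
    ext a
    simpa [counit_polynomial, Points.one_apply] using hF 0 a
  -- Both sides are determined by their values at pairs of natural numbers, where the identity
  -- reads `g ^ (i + j) = g ^ i * g ^ j`.
  have comul_comp : (Algebra.TensorProduct.map F F).comp (Bialgebra.comulAlgHom k A) =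
      (Bialgebra.comulAlgHom k k[X]).comp F := by
    ext a
    have separating (Q : k[X]) (hQ : ∀ j : ℕ, leval (j : k) Q = 0) : Q = 0 :=
      polynomial_eq_of_eval_natCast_eq fun j ↦ (hQ j).trans eval_zero.symm
    refine sub_eq_zero.1 (tensor_eq_zero_of_separating separating separating fun i j ↦ ?_)
    have eval_map : LinearMap.mul' k k (TensorProduct.map (leval (i : k)) (leval (j : k))
        (Algebra.TensorProduct.map F F (comul a))) = (g ^ i * g ^ j).ofConv a := by
      rw [Points.mul_apply _ _ (ℛ k a), ← (ℛ k a).eq]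
      simp [hF]
    rw [map_sub, map_sub, sub_eq_zero]
    refine eval_map.trans (Eq.trans ?_ (eval_comul_polynomial (i : k) (j : k) (F a)).symm)
    rw [← Nat.cast_add, hF, pow_add]
  exact ⟨.ofAlgHom F counit_comp comul_comp, fun j ↦ WithConv.ext <| AlgHom.ext fun a ↦ hF j a⟩

variable {k A : Type*} [CommRing k] [CommRing A] [Bialgebra k A]

theorem isTangentVector_lcoeff_one : IsTangentVector (lcoeff k 1 : k[X] →ₗ[k] k) := by
  intro P Q
  simp [counit_polynomial, coeff_zero_eq_eval_zero, mul_coeff_one, mul_comm]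

theorem leftInvariantOp_lcoeff_one (P : k[X]) :
    leftInvariantOp (lcoeff k 1) P = derivative P := by
  have h : leftInvariantDerivation (isTangentVector_lcoeff_one (k := k)) = derivative' := by
    refine derivation_ext ?_
    change (leftInvariantOp (lcoeff k 1) X : k[X]) = derivative X
    simp [leftInvariantOp, comul_polynomial, coeff_one]
  exact congr($h P)

/-- The velocity at `0` of a homomorphism from the additive group to `G`. -/
noncomputable def velocity (lam : A →ₐc[k] k[X]) : A →ₗ[k] k :=
  lcoeff k 1 ∘ₗ (lam : A →ₗ[k] k[X])

theorem isTangentVector_velocity (lam : A →ₐc[k] k[X]) : IsTangentVector (velocity lam) :=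
  isTangentVector_lcoeff_one.comp_bialgHom lam

theorem bialgHom_leftInvariantOp_velocity_pow (lam : A →ₐc[k] k[X]) (n : ℕ) (a : A) :
    lam ((leftInvariantOp (velocity lam) ^ n) a) = derivative^[n] (lam a) := by
  induction n with
  | zero => rfl
  | succ n ih =>
    rw [pow_succ', Module.End.mul_apply, Function.iterate_succ_apply', ← ih, velocity,
      coalgHom_leftInvariantOp, leftInvariantOp_lcoeff_one]

theorem counit_leftInvariantOp_velocity_pow (lam : A →ₐc[k] k[X]) (n : ℕ) (a : A) :
    counit (R := k) ((leftInvariantOp (velocity lam) ^ n) a) = n.factorial • (lam a).coeff n := by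
  rw [← CoalgHomClass.counit_comp_apply lam, bialgHom_leftInvariantOp_velocity_pow,
    counit_polynomial, ← coeff_zero_eq_eval_zero, coeff_iterate_derivative, zero_add,
    Nat.descFactorial_self]

theorem leftInvariantOp_velocity_locallyNilpotent (lam : A →ₐc[k] k[X]) (a : A) :
    ∃ n, (leftInvariantOp (velocity lam) ^ n) a = 0 := by
  let r := ℛ k a
  refine ⟨(r.index.sup fun i ↦ (lam (r.right i)).natDegree) + 1, ?_⟩
  rw [eq_leftInvariantOp_of_comul_comp (comul_comp_pow (comul_comp_leftInvariantOp _) _),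
    leftInvariantOp_apply _ r]
  refine Finset.sum_eq_zero fun i hi ↦ ?_
  have hi := Finset.le_sup (f := fun i ↦ (lam (r.right i)).natDegree) hi
  rw [LinearMap.comp_apply, counit_leftInvariantOp_velocity_pow,
    coeff_eq_zero_of_natDegree_lt (Nat.lt_succ_of_le hi), smul_zero, zero_smul]

end OneParameter

section DerivationStable

open Polynomial

variable {k : Type*} [Field k] [CharZero k]

theorem derivative_stable_subalgebra_eq_bot_or_eq_top {S : Subalgebra k k[X]}
    (hS : ∀ P ∈ S, derivative P ∈ S) : S = ⊥ ∨ S = ⊤ := by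
  by_cases hc : ∀ P ∈ S, P.natDegree = 0
  · refine .inl (eq_bot_iff.2 fun P hP ↦ Algebra.mem_bot.2 ⟨P.coeff 0, ?_⟩)
    exact (eq_C_of_natDegree_eq_zero (hc P hP)).symm
  push Not at hc
  obtain ⟨P, hP, hdeg⟩ := hc
  have exists_natDegree_eq_one (n : ℕ) : ∀ P ∈ S, P.natDegree = n + 1 →
      ∃ Q ∈ S, Q.natDegree = 1 := by
    induction n with
    | zero => exact fun P hP hdeg ↦ ⟨P, hP, hdeg⟩
    | succ n ih =>
      refine fun P hP hdeg ↦ ih _ (hS P hP) (natDegree_eq_of_degree_eq_some ?_)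
      rw [degree_derivative (by lia), hdeg, Nat.add_sub_cancel]
  obtain ⟨n, hn⟩ := Nat.exists_eq_succ_of_ne_zero hdeg
  obtain ⟨Q, hQ, hQdeg⟩ := exists_natDegree_eq_one n P hP hn
  obtain ⟨a, ha, b, rfl⟩ := natDegree_eq_one.1 hQdeg
  have X_mem : X ∈ S := by
    have h : (X : k[X]) = a⁻¹ • (C a * X + C b - C b) := by
      rw [add_sub_cancel_right, ← smul_eq_C_mul, inv_smul_smul₀ ha]
    rw [h]
    exact S.smul_mem (S.sub_mem hQ (S.algebraMap_mem b)) _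
  refine .inr (eq_top_iff.2 ?_)
  rw [← adjoin_X, Algebra.adjoin_le_iff, Set.singleton_subset_iff]
  exact X_mem

theorem range_eq_bot_or_eq_top {A : Type*} [CommRing A] [Bialgebra k A] (lam : A →ₐc[k] k[X]) :
    (lam : A →ₐ[k] k[X]).range = ⊥ ∨ (lam : A →ₐ[k] k[X]).range = ⊤ := by
  refine derivative_stable_subalgebra_eq_bot_or_eq_top ?_
  rintro _ ⟨a, rfl⟩
  exact ⟨_, bialgHom_leftInvariantOp_velocity_pow lam 1 a⟩

theorem exists_evalPoint_eq_iff {A : Type*} [CommRing A] [Bialgebra k A] (lam : A →ₐc[k] k[X])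
    {R : Type*} [CommRing R] [Algebra k R] {g : Points k A R} :
    (∃ t, evalPoint lam t = g) ↔ ∀ a, lam a = 0 → g.ofConv a = 0 := by
  refine ⟨?_, fun hg ↦ ?_⟩
  · rintro ⟨t, rfl⟩ a ha
    rw [evalPoint_apply, ha, map_zero]
  rcases range_eq_bot_or_eq_top lam with hlam | hlam
  · refine ⟨0, WithConv.ext <| AlgHom.ext fun a ↦ ?_⟩
    obtain ⟨c, hc⟩ := Algebra.mem_bot.1 (hlam ▸ (lam : A →ₐ[k] k[X]).mem_range_self a)
    have hc : lam a = algebraMap k k[X] c := hc.symm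
    have ha := hg (a - algebraMap k A c) (by rw [map_sub, AlgHomClass.commutes, hc, sub_self])
    rw [map_sub, sub_eq_zero, AlgHom.commutes] at ha
    rw [evalPoint_apply, hc, AlgHom.commutes, ha]
  · have hlam : Function.Surjective (lam : A →ₐ[k] k[X]) := AlgHom.range_eq_top _ |>.1 hlam
    let e : k[X] →ₐ[k] R := (lam : A →ₐ[k] k[X]).liftOfSurjective hlam g.ofConv hg
    have he : aeval (e X) = e := by ext; simp
    refine ⟨e X, WithConv.ext <| AlgHom.ext fun a ↦ ?_⟩
    rw [evalPoint_apply, he]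
    exact AlgHom.liftOfSurjective_apply (lam : A →ₐ[k] k[X]) hlam g.ofConv hg a

theorem ringKrullDim_quotient_ker_le_one {A : Type*} [CommRing A] [Bialgebra k A]
    (lam : A →ₐc[k] k[X]) : ringKrullDim (A ⧸ RingHom.ker lam) ≤ 1 := by
  let F : A →ₐ[k] k[X] := lam
  have h : ringKrullDim (A ⧸ RingHom.ker lam) = ringKrullDim F.range :=
    ringKrullDim_eq_of_ringEquiv (Ideal.quotientKerEquivRange F).toRingEquiv
  rw [h]
  rcases range_eq_bot_or_eq_top lam with hlam | hlam
  · rw [hlam, ringKrullDim_eq_of_ringEquiv (Algebra.botEquiv k k[X]).toRingEquiv,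
      ringKrullDim_eq_zero_of_field]
    exact zero_le_one
  · rw [hlam, ringKrullDim_eq_of_ringEquiv Subalgebra.topEquiv.toRingEquiv,
      ringKrullDim_of_isNoetherianRing, ringKrullDim_eq_zero_of_field, zero_add]

end DerivationStable

section OneParameterSubgroup

open Polynomial

variable {k : Type v} {A : Type u} [Field k] [CharZero k] [CommRing A] [HopfAlgebra k A]

theorem exists_isOneParamUnipotent_mem_iff (lam : A →ₐc[k] k[X]) :
    ∃ S : Subgroup (Points k A k), IsOneParamUnipotent S ∧
      ∀ g, g ∈ S ↔ ∃ t, evalPoint lam t = g := by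
  have hI := isHopfIdeal_ker lam
  let quot : A →ₐc[k] A ⧸ RingHom.ker lam := Bialgebra.Quotient.mkBialgHom (R := k) _
  have hquot : Function.Surjective quot := Ideal.Quotient.mk_surjective
  have mem_range_iff {R : Type v} [CommRing R] [Algebra k R] (g : Points k A R) :
      (∃ h, pointsMap quot R h = g) ↔ ∃ t, evalPoint lam t = g := by
    rw [exists_pointsMap_eq_iff hquot, exists_evalPoint_eq_iff]
    exact forall_congr' fun a ↦ imp_congr_left Ideal.Quotient.eq_zero_iff_mem
  refine ⟨_, ⟨RingHom.ker lam, hI, isUnipotentGroup_iff.2 fun g ↦ ?_,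
    ringKrullDim_quotient_ker_le_one lam, rfl⟩, mem_range_iff⟩
  obtain ⟨t, ht⟩ := (mem_range_iff (pointsMap quot _ g)).1 ⟨g, rfl⟩
  exact .of_pointsMap hquot (ht ▸ hasPolynomialPowers_evalPoint lam t)

theorem IsOneParamUnipotent.exists_evalPoint_eq {S : Subgroup (Points k A k)}
    (hS : IsOneParamUnipotent S) {g : Points k A k} (hg : g ∈ S) :
    ∃ lam : A →ₐc[k] k[X], evalPoint lam 1 = g ∧ ∀ t : k, evalPoint lam t ∈ S := by
  obtain ⟨I, _, hI, -, rfl⟩ := hS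
  obtain ⟨h, rfl⟩ := hg
  obtain ⟨lam, hlam⟩ := exists_evalPoint_natCast_eq_pow <|
    HasPolynomialPowers.of_mapCoeff (isUnipotentGroup_iff.1 hI (Points.mapCoeff _ h))
  refine ⟨lam.comp (Bialgebra.Quotient.mkBialgHom (R := k) I), ?_, fun t ↦ ⟨evalPoint lam t, rfl⟩⟩
  have hone := hlam 1
  rw [Nat.cast_one, pow_one] at hone
  rw [← hone]
  rfl

theorem plus_eq_closure (L : Subgroup (Points k A k)) :
    plus L = Subgroup.closure
      {g | ∃ lam : A →ₐc[k] k[X], evalPoint lam 1 = g ∧ ∀ t : k, evalPoint lam t ∈ L} := by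
  refine le_antisymm (sSup_le ?_) (Subgroup.closure_le _ |>.2 ?_)
  · rintro S ⟨hS, hSL⟩ g hg
    obtain ⟨lam, hone, hlam⟩ := hS.exists_evalPoint_eq hg
    exact Subgroup.subset_closure ⟨lam, hone, fun t ↦ hSL (hlam t)⟩
  · rintro _ ⟨lam, rfl, hlam⟩
    obtain ⟨S, hS, mem_S⟩ := exists_isOneParamUnipotent_mem_iff lam
    have hSL : S ≤ L := by
      intro g hg
      obtain ⟨t, rfl⟩ := (mem_S g).1 hg
      exact hlam t
    exact le_sSup (show S ∈ {S | IsOneParamUnipotent S ∧ S ≤ L} from ⟨hS, hSL⟩)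
      ((mem_S _).2 ⟨1, rfl⟩)

theorem map_plus_le {B : Type u} [CommRing B] [HopfAlgebra k B] (f : A →ₐc[k] B)
    (L : Subgroup (Points k B k)) :
    (plus L).map (pointsMap f k) ≤ plus (L.map (pointsMap f k)) := by
  rw [plus_eq_closure, plus_eq_closure, MonoidHom.map_closure, Subgroup.closure_le]
  rintro _ ⟨_, ⟨lam, rfl, hlam⟩, rfl⟩
  exact Subgroup.subset_closure ⟨lam.comp f, rfl, fun t ↦ ⟨_, hlam t, rfl⟩⟩

end OneParameterSubgroup

section Leibniz

theorem commute_rTensor_lTensor {R M N : Type*} [CommRing R] [AddCommGroup M] [Module R M]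
    [AddCommGroup N] [Module R N] (S : Module.End R M) (T : Module.End R N) :
    Commute (S.rTensor N) (T.lTensor M) :=
  (LinearMap.rTensor_comp_lTensor ..).trans (LinearMap.lTensor_comp_rTensor ..).symm

theorem leibniz_iff_comp_mul' {R A : Type*} [CommRing R] [CommRing A] [Algebra R A]
    (T : Module.End R A) : (∀ a b, T (a * b) = a • T b + b • T a) ↔
      T ∘ₗ LinearMap.mul' R A = LinearMap.mul' R A ∘ₗ (T.rTensor A + T.lTensor A) := by
  refine ⟨fun h ↦ TensorProduct.ext' fun a b ↦ ?_, fun h a b ↦ ?_⟩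
  · simp [h, add_comm, mul_comm]
  · simpa [add_comm, mul_comm] using congr($h (a ⊗ₜ b))

theorem comp_pow_eq_pow_comp {R M N : Type*} [CommRing R] [AddCommGroup M] [Module R M]
    [AddCommGroup N] [Module R N] {f : M →ₗ[R] N} {S : Module.End R M} {T : Module.End R N}
    (h : T ∘ₗ f = f ∘ₗ S) (n : ℕ) : (T ^ n) ∘ₗ f = f ∘ₗ (S ^ n) := by
  induction n with
  | zero => rfl
  | succ n ih =>
    rw [pow_succ, pow_succ, Module.End.mul_eq_comp, Module.End.mul_eq_comp, LinearMap.comp_assoc,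
      h, ← LinearMap.comp_assoc, ih, LinearMap.comp_assoc]

theorem derivation_pow_apply_mul {R A : Type*} [CommRing R] [CommRing A] [Algebra R A]
    (D : Derivation R A A) (n : ℕ) (a b : A) :
    ((D : Module.End R A) ^ n) (a * b) = ∑ m ∈ Finset.HasAntidiagonal.antidiagonal n,
      n.choose m.1 • (((D : Module.End R A) ^ m.1) a * ((D : Module.End R A) ^ m.2) b) := by
  have h := congr($(comp_pow_eq_pow_comp ((leibniz_iff_comp_mul' (D : Module.End R A)).1
    D.leibniz) n) (a ⊗ₜ b))
  rw [(commute_rTensor_lTensor (D : Module.End R A) (D : Module.End R A)).add_pow'] at h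
  simpa [LinearMap.rTensor_pow, LinearMap.lTensor_pow, -nsmul_eq_mul] using h

end Leibniz

section Exponential

open Coalgebra Polynomial

theorem polynomial_eq_of_factorial_smul_coeff_eq {F : Type*} [Field F] [CharZero F] {P Q : F[X]}
    (h : ∀ n : ℕ, n.factorial • P.coeff n = n.factorial • Q.coeff n) : P = Q :=
  Polynomial.ext fun n ↦ smul_right_injective F n.factorial_ne_zero (h n)

theorem exists_polynomial_factorial_smul_coeff_eq {F : Type*} [Field F] [CharZero F] {f : ℕ → F}
    {m : ℕ} (hf : ∀ n, m ≤ n → f n = 0) : ∃ P : F[X], ∀ n, n.factorial • P.coeff n = f n := by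
  refine ⟨∑ n ∈ Finset.range m, monomial n (f n / n.factorial), fun n ↦ ?_⟩
  simp only [finsetSum_coeff, coeff_monomial, Finset.sum_ite_eq', Finset.mem_range]
  split_ifs with hn
  · rw [nsmul_eq_mul, mul_div_cancel₀ _ (Nat.cast_ne_zero.2 n.factorial_ne_zero)]
  · rw [hf n (not_lt.1 hn), smul_zero]

variable {k : Type*} [Field k]

theorem coeff_comul_polynomial (P : k[X]) (i j : ℕ) :
    LinearMap.mul' k k (TensorProduct.map (lcoeff k i) (lcoeff k j) (comul (R := k) P)) =
      (i + j).choose i • P.coeff (i + j) := by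
  suffices h : LinearMap.mul' k k ∘ₗ TensorProduct.map (lcoeff k i) (lcoeff k j) ∘ₗ comul =
      (i + j).choose i • lcoeff k (i + j) from congr($h P)
  refine lhom_ext' fun n ↦ LinearMap.ext_ring ?_
  have binomial : (X ⊗ₜ 1 + 1 ⊗ₜ X : k[X] ⊗[k] k[X]) ^ n =
      ∑ m ∈ Finset.HasAntidiagonal.antidiagonal n, n.choose m.1 • ((X ^ m.1) ⊗ₜ (X ^ m.2)) := by
    rw [(Commute.all _ _).add_pow']
    simp [Algebra.TensorProduct.tmul_pow, -nsmul_eq_mul]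
  have coeff_tmul (m : ℕ × ℕ) : LinearMap.mul' k k (TensorProduct.map (lcoeff k i) (lcoeff k j)
      ((X ^ m.1) ⊗ₜ (X ^ m.2))) = if m = (i, j) then 1 else 0 := by
    simp only [TensorProduct.map_tmul, lcoeff_apply, coeff_X_pow, LinearMap.mul'_apply,
      Prod.ext_iff, eq_comm (a := i), eq_comm (a := j), ite_zero_mul_ite_zero, mul_one]
  simp only [LinearMap.comp_apply, LinearMap.smul_apply, lcoeff_apply, comul_polynomial,
    ← X_pow_eq_monomial, map_pow, aeval_X, binomial, map_sum, map_nsmul, coeff_tmul, coeff_X_pow,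
    smul_ite, smul_zero, Finset.sum_ite_eq', Finset.HasAntidiagonal.mem_antidiagonal]
  split_ifs with h <;> simp_all

variable {A : Type*} [CommRing A]

theorem exists_algHom_factorial_smul_coeff_eq [CharZero k] [Algebra k A] (ε : A →ₐ[k] k)
    (D : Derivation k A A) (hnil : ∀ a, ∃ n, ((D : Module.End k A) ^ n) a = 0) :
    ∃ F : A →ₐ[k] k[X], ∀ a n, n.factorial • (F a).coeff n = ε (((D : Module.End k A) ^ n) a) := by
  have exists_polynomial (a : A) :
      ∃ P : k[X], ∀ n, n.factorial • P.coeff n = ε (((D : Module.End k A) ^ n) a) := by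
    obtain ⟨m, hm⟩ := hnil a
    refine exists_polynomial_factorial_smul_coeff_eq (m := m) fun n hn ↦ ?_
    rw [← Nat.sub_add_cancel hn, pow_add, Module.End.mul_apply, hm, map_zero, map_zero]
  choose P hP using exists_polynomial
  refine ⟨AlgHom.ofLinearMap ⟨⟨P, fun a b ↦ ?_⟩, fun c a ↦ ?_⟩ ?_ fun a b ↦ ?_, hP⟩
  all_goals refine polynomial_eq_of_factorial_smul_coeff_eq fun n ↦ ?_
  · simp only [coeff_add, smul_add, hP, map_add]
  · simp only [RingHom.id_apply, coeff_smul, smul_comm _ c, hP, map_smul]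
  · change n.factorial • (P 1).coeff n = _
    rw [hP]
    rcases n with _ | n
    · simp
    · simp [pow_succ, coeff_one]
  · change n.factorial • (P (a * b)).coeff n = n.factorial • (P a * P b).coeff n
    rw [hP, derivation_pow_apply_mul, coeff_mul, map_sum, Finset.smul_sum]
    refine Finset.sum_congr rfl fun m hm ↦ ?_
    obtain rfl := Finset.HasAntidiagonal.mem_antidiagonal.1 hm
    rw [map_nsmul, map_mul, ← hP, ← hP,
      ← Nat.add_choose_mul_factorial_mul_factorial, ← Nat.choose_symm_add]
    simp only [nsmul_eq_mul, Nat.cast_mul]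
    ring

theorem exists_bialgHom_factorial_smul_coeff_eq [CharZero k] [Bialgebra k A]
    (D : Derivation k A A) (hnil : ∀ a, ∃ n, ((D : Module.End k A) ^ n) a = 0)
    (hD : comul ∘ₗ (D : A →ₗ[k] A) = (D : A →ₗ[k] A).lTensor A ∘ₗ comul) :
    ∃ mu : A →ₐc[k] k[X], ∀ a n,
      n.factorial • (mu a).coeff n = counit (R := k) (((D : Module.End k A) ^ n) a) := by
  obtain ⟨F, hF⟩ := exists_algHom_factorial_smul_coeff_eq (Bialgebra.counitAlgHom k A) D hnil
  have counit_comp : (Bialgebra.counitAlgHom k k[X]).comp F = Bialgebra.counitAlgHom k A := by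
    ext a
    simpa [counit_polynomial, coeff_zero_eq_eval_zero] using hF a 0
  -- The coefficients of `Xⁱ ⊗ Xʲ` agree because `Dⁱ ∘ Dʲ = Dⁱ⁺ʲ`.
  have comul_comp : (Algebra.TensorProduct.map F F).comp (Bialgebra.comulAlgHom k A) =
      (Bialgebra.comulAlgHom k k[X]).comp F := by
    ext a
    have separating (Q : k[X]) (hQ : ∀ j : ℕ, lcoeff k j Q = 0) : Q = 0 := Polynomial.ext hQ
    refine sub_eq_zero.1 (tensor_eq_zero_of_separating separating separating fun i j ↦ ?_)
    have eval_map : (i.factorial * j.factorial) •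
        LinearMap.mul' k k (TensorProduct.map (lcoeff k i) (lcoeff k j)
          (Algebra.TensorProduct.map F F (comul a))) =
        counit (R := k) (((D : Module.End k A) ^ (i + j)) a) := by
      rw [pow_add, Module.End.mul_apply, eq_leftInvariantOp_of_comul_comp (comul_comp_pow hD j),
        leftInvariantOp_apply _ (ℛ k a), ← (ℛ k a).eq]
      simp only [map_sum, Finset.smul_sum]
      refine Finset.sum_congr rfl fun r _ ↦ ?_
      rw [map_smul, map_smul, LinearMap.comp_apply]
      have hi := hF ((ℛ k a).left r) i
      have hj := hF ((ℛ k a).right r) j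
      simp only [Bialgebra.counitAlgHom_apply] at hi hj
      simp only [Algebra.TensorProduct.map_tmul, TensorProduct.map_tmul, lcoeff_apply,
        LinearMap.mul'_apply, nsmul_eq_mul, Nat.cast_mul, ← hj, ← hi, smul_eq_mul]
      ring
    rw [map_sub, map_sub, sub_eq_zero]
    refine smul_right_injective k (mul_pos i.factorial_pos j.factorial_pos).ne' (eval_map.trans ?_)
    refine (hF a (i + j)).symm.trans ?_
    change _ = (i.factorial * j.factorial) • LinearMap.mul' k k
      (TensorProduct.map (lcoeff k i) (lcoeff k j) (comul (R := k) (F a)))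
    rw [coeff_comul_polynomial, ← mul_smul, mul_comm, ← mul_assoc, Nat.choose_symm_add,
      Nat.add_choose_mul_factorial_mul_factorial]
  exact ⟨.ofAlgHom F counit_comp comul_comp, hF⟩

end Exponential

section DerivationExtension

theorem exists_derivation_extension_of_formallySmooth {R S T M : Type*} [CommRing R] [CommRing S]
    [CommRing T] [Algebra R S] [Algebra R T] [Algebra S T] [IsScalarTower R S T]
    [Algebra.FormallySmooth S T] [AddCommGroup M] [Module R M] [Module S M] [Module T M]
    [IsScalarTower R T M] [IsScalarTower S T M] (d : Derivation R S M) :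
    ∃ δ : Derivation R T M, ∀ x, δ (algebraMap S T x) = d x := by
  have injective : Function.Injective (KaehlerDifferential.mapBaseChange R S T) := by
    rw [injective_iff_map_eq_zero]
    intro x hx
    obtain ⟨y, rfl⟩ := (Algebra.H1Cotangent.exact_δ_mapBaseChange R S T x).1 hx
    rw [Subsingleton.elim y 0, map_zero]
  obtain ⟨retraction, h_retraction⟩ :=
    ((KaehlerDifferential.exact_mapBaseChange_map R S T).split_tfae'.out 0 1 rfl rfl |>.1
      ⟨injective, Module.projective_lifting_property _ _
        (KaehlerDifferential.map_surjective_of_surjective R S T T Function.surjective_id)⟩).2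
  have : IsScalarTower R S M := .to₁₂₄ R S T M
  let f : T ⊗[S] Ω[S⁄R] →ₗ[T] M := LinearMap.liftBaseChange T d.liftKaehlerDifferential
  refine ⟨(f ∘ₗ retraction).compDer (KaehlerDifferential.D R T), fun x ↦ ?_⟩
  have h := congr($h_retraction (1 ⊗ₜ KaehlerDifferential.D R S x))
  rw [LinearMap.comp_apply, KaehlerDifferential.mapBaseChange_tmul, one_smul,
    KaehlerDifferential.map_D] at h
  change f (retraction (KaehlerDifferential.D R T (algebraMap S T x))) = d x
  rw [h]
  simp [f]

theorem formallySmooth_of_faithfulSMul {R L : Type*} [CommRing R] [Field L] [CharZero L]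
    [Algebra R L] [FaithfulSMul R L] : Algebra.FormallySmooth R L := by
  have hinj := FaithfulSMul.algebraMap_injective R L
  have : IsDomain R := hinj.isDomain
  let := FractionRing.liftAlgebra R L
  have := FractionRing.isScalarTower_liftAlgebra R L
  have : CharZero (FractionRing R) := (algebraMap (FractionRing R) L).charZero
  have : Algebra.FormallyEtale R (FractionRing R) := .of_isLocalization (nonZeroDivisors R)
  obtain ⟨b, hb⟩ := exists_isTranscendenceBasis (FractionRing R) L
  have := hb.isAlgebraic_field
  have : Algebra.FormallySmooth (FractionRing R) L := .of_algebraicIndependent_of_isSeparable hb.1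
  exact .comp R (FractionRing R) L

/-- The largest ideal contained in `I` which is stable under the derivation `D`. -/
def derivationCore {R A : Type*} [CommRing R] [CommRing A] [Algebra R A] (D : Derivation R A A)
    (I : Ideal A) : Ideal A where
  carrier := {x | ∀ n, ((D : Module.End R A) ^ n) x ∈ I}
  zero_mem' n := by simp
  add_mem' hx hy n := by rw [map_add]; exact I.add_mem (hx n) (hy n)
  smul_mem' a x hx n := by
    rw [smul_eq_mul, derivation_pow_apply_mul]
    exact I.sum_mem fun m _ ↦ I.smul_of_tower_mem _ (I.mul_mem_left _ (hx _))

theorem derivationCore_le {R A : Type*} [CommRing R] [CommRing A] [Algebra R A]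
    (D : Derivation R A A) (I : Ideal A) : derivationCore D I ≤ I :=
  fun _ hx ↦ hx 0

variable {k A : Type*} [Field k] [CharZero k] [CommRing A] [Algebra k A]

theorem derivationCore_isPrime (D : Derivation k A A) (p : Ideal A) [p.IsPrime] :
    (derivationCore D p).IsPrime := by
  refine ⟨fun h ↦ Ideal.IsPrime.ne_top' (top_le_iff.1 (h ▸ derivationCore_le D p)),
    fun {x y} hxy ↦ ?_⟩
  by_contra! h
  have hx : ∃ i, ((D : Module.End k A) ^ i) x ∉ p := not_forall.1 h.1
  have hy : ∃ j, ((D : Module.End k A) ^ j) y ∉ p := not_forall.1 h.2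
  classical
  let i := Nat.find hx
  let j := Nat.find hy
  -- All the other terms of the Leibniz formula for `D ^ (i + j)` lie in `p`.
  have leading_mem : (i + j).choose i •
      (((D : Module.End k A) ^ i) x * ((D : Module.End k A) ^ j) y) ∈ p := by
    have hsum := hxy (i + j)
    rw [derivation_pow_apply_mul, ← Finset.add_sum_erase _ _
      (Finset.HasAntidiagonal.mem_antidiagonal.2 (rfl : (i, j).1 + (i, j).2 = i + j))] at hsum
    refine (p.add_mem_iff_left (p.sum_mem fun m hm ↦ p.smul_of_tower_mem _ ?_)).1 hsum
    obtain ⟨hne, hm⟩ := Finset.mem_erase.1 hm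
    rw [Finset.HasAntidiagonal.mem_antidiagonal] at hm
    rcases lt_or_ge m.1 i with hlt | hge
    · exact p.mul_mem_right _ (not_not.1 (Nat.find_min hx hlt))
    · have hne : m.1 ≠ i := fun h ↦ hne (Prod.ext h (by lia))
      exact p.mul_mem_left _ (not_not.1 (Nat.find_min hy (show m.2 < j by lia)))
  have choose_ne_zero : ((i + j).choose i : k) ≠ 0 :=
    Nat.cast_ne_zero.2 (Nat.choose_pos (Nat.le_add_right i j)).ne'
  rw [← Nat.cast_smul_eq_nsmul k, ← Submodule.restrictScalars_mem k,
    Submodule.smul_mem_iff _ choose_ne_zero] at leading_mem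
  exact (Ideal.IsPrime.mem_or_mem ‹_› leading_mem).elim (Nat.find_spec hx) (Nat.find_spec hy)

theorem derivation_mem_of_mem_minimalPrimes (D : Derivation k A A) {p : Ideal A}
    (hp : p ∈ minimalPrimes A) {x : A} (hx : x ∈ p) : D x ∈ p := by
  have : p.IsPrime := hp.isPrime
  exact hp.2 ⟨derivationCore_isPrime D p, bot_le⟩ (derivationCore_le D p) hx 1

theorem exists_derivation_field_comp_eq {L : Type*} [Field L] [Algebra k L] (q : A →ₐ[k] L)
    (D : Derivation k A A) (hD : ∀ x, q x = 0 → q (D x) = 0) :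
    ∃ δ : Derivation k L L, ∀ x, δ (q x) = q (D x) := by
  let : Algebra (A ⧸ RingHom.ker q) L := (Ideal.kerLiftAlg q).toAlgebra
  have : IsScalarTower k (A ⧸ RingHom.ker q) L := .of_algHom (Ideal.kerLiftAlg q)
  have : FaithfulSMul (A ⧸ RingHom.ker q) L :=
    (faithfulSMul_iff_algebraMap_injective _ _).2 (Ideal.kerLiftAlg_injective q)
  have : CharZero L := charZero_of_injective_algebraMap (algebraMap k L).injective
  have := formallySmooth_of_faithfulSMul (R := A ⧸ RingHom.ker q) (L := L)
  have hmk : Function.Surjective (Ideal.Quotient.mkₐ k (RingHom.ker q)) :=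
    Ideal.Quotient.mk_surjective
  have hD' (x : A) (hx : Ideal.Quotient.mkₐ k (RingHom.ker q) x = 0) :
      Ideal.Quotient.mkₐ k (RingHom.ker q) (D x) = 0 :=
    Ideal.Quotient.eq_zero_iff_mem.2 (hD x (Ideal.Quotient.eq_zero_iff_mem.1 hx))
  obtain ⟨δ, hδ⟩ := exists_derivation_extension_of_formallySmooth (T := L)
    ((Algebra.linearMap (A ⧸ RingHom.ker q) L).compDer (Derivation.liftOfSurjective hmk hD'))
  refine ⟨δ, fun x ↦ (hδ (Ideal.Quotient.mkₐ k _ x)).trans ?_⟩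
  exact congrArg (algebraMap _ L) (Derivation.liftOfSurjective_apply hmk hD' x)

theorem exists_derivation_residueField_comp_eq [Nontrivial A] {B : Type*} [CommRing B]
    [Algebra k B] {φ : A →ₐ[k] B} (hφ : Function.Injective φ) (D : Derivation k A A) :
    ∃ (P : Ideal B) (_ : P.IsPrime) (δ : Derivation k B P.ResidueField),
      ∀ a, δ (φ a) = algebraMap B P.ResidueField (φ (D a)) := by
  obtain ⟨p, hp⟩ : Nonempty (minimalPrimes A) := Ideal.nonempty_minimalPrimes bot_ne_top
  obtain ⟨P, hP, rfl⟩ := Ideal.exists_comap_eq_of_mem_minimalPrimes_of_injective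
    (f := (φ : A →+* B)) hφ p hp
  have mem_iff (b : B) := Ideal.algebraMap_residueField_eq_zero (I := P) (x := b)
  obtain ⟨δ, hδ⟩ := exists_derivation_field_comp_eq
    ((IsScalarTower.toAlgHom k B P.ResidueField).comp φ) D fun x hx ↦
      (mem_iff _).2 <| derivation_mem_of_mem_minimalPrimes D hp <| (mem_iff _).1 hx
  exact ⟨P, hP, δ.compAlgebraMap B, hδ⟩

end DerivationExtension

section TangentLift

open Coalgebra HopfAlgebra

theorem sum_antipode_mul_leftInvariantOp {k A : Type*} [CommRing k] [CommRing A] [HopfAlgebra k A]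
    (f : A →ₗ[k] k) {a : A} {κ : Type*} (r : Repr k a κ) :
    ∑ i ∈ r.index, antipode k (r.left i) * leftInvariantOp f (r.right i) =
      algebraMap k A (f a) := by
  have h := mul_antipode_rTensor_comul_apply (R := k) (leftInvariantOp f a)
  have h_comul : comul (leftInvariantOp f a) = (leftInvariantOp f).lTensor A (comul a) :=
    congr($(comul_comp_leftInvariantOp f) a)
  rw [h_comul, counit_leftInvariantOp, ← r.eq] at h
  simpa using h

section

variable {R B M : Type*} [CommRing R] [CommRing B] [HopfAlgebra R B] [AddCommGroup M] [Module R M]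
  [Module B M] [IsScalarTower R B M]

/-- The translate to the neutral element of a derivation of `R[G]` with values in `M`. If `M` is
an `R[G]`-algebra `L` and `g : G(L)` the corresponding point, then a derivation with values in `L`
is a tangent vector at `g`, and its translate by `g⁻¹` is `b ↦ ∑ S(b₁) • δ(b₂)`. -/
noncomputable def translateToOne (δ : Derivation R B M) : B →ₗ[R] M :=
  TensorProduct.lift ((Algebra.lsmul R R M).toLinearMap.compl₂ (δ : B →ₗ[R] M) ∘ₗ
    antipode R) ∘ₗ comul

theorem translateToOne_apply (δ : Derivation R B M) {b : B} {κ : Type*} (r : Repr R b κ) :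
    translateToOne δ b = ∑ i ∈ r.index, antipode R (r.left i) • δ (r.right i) := by
  rw [translateToOne, LinearMap.comp_apply, ← r.eq, map_sum]
  simp

theorem translateToOne_mul (δ : Derivation R B M) (a b : B) :
    translateToOne δ (a * b) =
      counit (R := R) a • translateToOne δ b + counit (R := R) b • translateToOne δ a := by
  let Φ : B ⊗[R] B →ₗ[R] M := TensorProduct.lift
    ((Algebra.lsmul R R M).toLinearMap.compl₂ (δ : B →ₗ[R] M) ∘ₗ antipode R)
  let ν : B ⊗[R] B →ₗ[R] B := LinearMap.mul' R B ∘ₗ (antipode R).rTensor B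
  have leibniz (z w : B ⊗[R] B) : Φ (z * w) = ν z • Φ w + ν w • Φ z := by
    induction z with
    | zero => simp
    | add z z' hz hz' => simp only [add_mul, map_add, hz, hz', add_smul, smul_add]; abel
    | tmul a a' =>
      induction w with
      | zero => simp
      | add w w' hw hw' => simp only [mul_add, map_add, hw, hw', add_smul, smul_add]; abel
      | tmul b b' =>
        simp only [Algebra.TensorProduct.tmul_mul_tmul, TensorProduct.lift.tmul,
          LinearMap.coe_comp, Function.comp_apply, antipode_mul_distrib, LinearMap.compl₂_apply,
          AlgHom.toLinearMap_apply, map_mul, Derivation.coeFn_coe, Derivation.leibniz,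
          Module.End.mul_apply, Algebra.lsmul_coe, smul_add, smul_smul, LinearMap.rTensor_tmul,
          LinearMap.mul'_apply, Φ, ν]
        ring_nf
  have ν_comul (b : B) : ν (comul b) = algebraMap R B (counit b) :=
    mul_antipode_rTensor_comul_apply b
  change Φ (comul (a * b)) = _
  rw [Bialgebra.comul_mul, leibniz, ν_comul, ν_comul, algebraMap_smul, algebraMap_smul]
  rfl

end

variable {k A B : Type*} [Field k] [CharZero k] [CommRing A] [HopfAlgebra k A] [CommRing B]
  [HopfAlgebra k B]

theorem IsTangentVector.exists_comp_bialgHom_eq {f : A →ₗ[k] k} (hf : IsTangentVector f)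
    {φ : A →ₐc[k] B} (hφ : Function.Injective φ) :
    ∃ g : B →ₗ[k] k, IsTangentVector g ∧ g ∘ₗ (φ : A →ₗ[k] B) = f := by
  have : Nontrivial A := (Bialgebra.counitAlgHom k A).toRingHom.domain_nontrivial
  obtain ⟨P, _, δ, hδ⟩ := exists_derivation_residueField_comp_eq (φ := (φ : A →ₐ[k] B)) hφ
    (leftInvariantDerivation hf)
  have translateToOne_comp (a : A) :
      translateToOne δ (φ a) = algebraMap k P.ResidueField (f a) := by
    have hδ (x : A) : δ (φ x) = algebraMap B P.ResidueField (φ (leftInvariantOp f x)) := hδ x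
    have hφf : φ (algebraMap k A (f a)) = algebraMap k B (f a) :=
      AlgHomClass.commutes (φ : A →ₐ[k] B) (f a)
    rw [translateToOne_apply δ ((ℛ k a).induced φ), IsScalarTower.algebraMap_apply k B, ← hφf,
      ← sum_antipode_mul_leftInvariantOp f (ℛ k a), map_sum, map_sum]
    refine Finset.sum_congr rfl fun i _ ↦ ?_
    change antipode k (φ _) • δ (φ _) = _
    rw [hδ, map_mul, map_mul, bialgHom_antipode, Algebra.smul_def]
  obtain ⟨r, hr⟩ := (Algebra.linearMap k P.ResidueField).exists_leftInverse_of_injective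
    (LinearMap.ker_eq_bot.2 (algebraMap k P.ResidueField).injective)
  refine ⟨r ∘ₗ translateToOne δ, fun a b ↦ ?_, LinearMap.ext fun a ↦ ?_⟩
  · simp only [LinearMap.comp_apply, translateToOne_mul, map_add, map_smul, smul_eq_mul]
  · exact (congrArg r (translateToOne_comp a)).trans congr($hr (f a))

end TangentLift

section NilpotentPart

open Polynomial

variable {k : Type*} [Field k]

/-- The class of `n` is the nilpotent part of the class of `X` in `k[X] / (g)`: modulo `g`, `n` is
nilpotent, and `X - n` is semisimple, being a root of a squarefree polynomial. -/
def IsNilpotentPartMod (n g : k[X]) : Prop :=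
  (∃ m, g ∣ n ^ m) ∧ ∃ p : k[X], Squarefree p ∧ g ∣ p.comp (X - n)

theorem isNilpotentPartMod_iff {n g : k[X]} (hg : g ≠ 0) : IsNilpotentPartMod n g ↔
    IsNilpotent (Algebra.lmul k (AdjoinRoot g) (AdjoinRoot.mk g n)) ∧
      (Algebra.lmul k (AdjoinRoot g) (AdjoinRoot.mk g (X - n))).IsSemisimple := by
  have : Module.Finite k (AdjoinRoot g) := (AdjoinRoot.powerBasis hg).finite
  have lmul_eq_zero_iff (f : k[X]) :
      Algebra.lmul k (AdjoinRoot g) (AdjoinRoot.mk g f) = 0 ↔ g ∣ f := by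
    rw [map_eq_zero_iff _ Algebra.lmul_injective, AdjoinRoot.mk_eq_zero]
  have aeval_lmul (p : k[X]) : aeval (Algebra.lmul k (AdjoinRoot g) (AdjoinRoot.mk g (X - n))) p =
      Algebra.lmul k (AdjoinRoot g) (AdjoinRoot.mk g (p.comp (X - n))) := by
    rw [aeval_algHom_apply, comp_eq_aeval, ← AdjoinRoot.coe_mkₐ, aeval_algHom_apply]
  refine and_congr (exists_congr fun m ↦ ?_) ⟨?_, fun h ↦ ⟨_, h.minpoly_squarefree, ?_⟩⟩
  · rw [← map_pow, ← map_pow, lmul_eq_zero_iff]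
  · rintro ⟨p, hp, hdvd⟩
    exact Module.End.isSemisimple_of_squarefree_aeval_eq_zero hp
      ((aeval_lmul p).trans ((lmul_eq_zero_iff _).2 hdvd))
  · rw [← lmul_eq_zero_iff, ← aeval_lmul, minpoly.aeval]

variable {V : Type*} [AddCommGroup V] [Module k V]

/-- An operator is locally algebraic if every vector is annihilated by a nonzero polynomial in it;
this is where the Jordan decomposition makes sense. -/
def IsLocallyAlgebraic (T : Module.End k V) : Prop :=
  ∀ v, ∃ g : k[X], g ≠ 0 ∧ aeval T g v = 0

theorem isLocallyAlgebraic_of_finiteDimensional [FiniteDimensional k V] (T : Module.End k V) :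
    IsLocallyAlgebraic T := fun v ↦
  ⟨minpoly k T, minpoly.ne_zero_of_finite k T, by rw [minpoly.aeval, LinearMap.zero_apply]⟩

theorem isLocallyAlgebraic_of_locallyNilpotent {T : Module.End k V}
    (h : ∀ v, ∃ n, (T ^ n) v = 0) : IsLocallyAlgebraic T := fun v ↦
  let ⟨n, hn⟩ := h v
  ⟨X ^ n, pow_ne_zero _ X_ne_zero, by rwa [map_pow, aeval_X]⟩

theorem aeval_apply_eq_zero_of_dvd {T : Module.End k V} {g f : k[X]} (h : g ∣ f) {v : V}
    (hv : aeval T g v = 0) : aeval T f v = 0 := by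
  obtain ⟨c, rfl⟩ := h
  rw [mul_comm, map_mul, Module.End.mul_apply, hv, map_zero]

theorem exists_ne_zero_aeval_add_apply_eq_zero {T : Module.End k V} {v w : V}
    (hv : ∃ g : k[X], g ≠ 0 ∧ aeval T g v = 0) (hw : ∃ g : k[X], g ≠ 0 ∧ aeval T g w = 0) :
    ∃ g : k[X], g ≠ 0 ∧ aeval T g (v + w) = 0 := by
  obtain ⟨g, hg, hgv⟩ := hv
  obtain ⟨g', hg', hgw⟩ := hw
  refine ⟨g * g', mul_ne_zero hg hg', ?_⟩
  rw [map_add, aeval_apply_eq_zero_of_dvd (dvd_mul_right g g') hgv,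
    aeval_apply_eq_zero_of_dvd (dvd_mul_left g' g) hgw, add_zero]

theorem aeval_comp_eq_comp_aeval {V' : Type*} [AddCommGroup V'] [Module k V'] {T : Module.End k V}
    {T' : Module.End k V'} {f : V →ₗ[k] V'} (h : T' ∘ₗ f = f ∘ₗ T) (p : k[X]) :
    aeval T' p ∘ₗ f = f ∘ₗ aeval T p := by
  induction p using Polynomial.induction_on' with
  | add p q hp hq => rw [map_add, map_add, LinearMap.add_comp, LinearMap.comp_add, hp, hq]
  | monomial n c =>
    rw [aeval_monomial, aeval_monomial, ← Algebra.smul_def, ← Algebra.smul_def,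
      LinearMap.smul_comp, LinearMap.comp_smul, comp_pow_eq_pow_comp h]

theorem exists_finiteDimensional_mem_invtSubmodule {S T : Module.End k V}
    (hS : IsLocallyAlgebraic S) (hT : IsLocallyAlgebraic T) (hST : Commute S T) (v : V) :
    ∃ W : Submodule k V, FiniteDimensional k W ∧ v ∈ W ∧ W ∈ S.invtSubmodule ∧
      W ∈ T.invtSubmodule := by
  obtain ⟨g, hg, hgv⟩ := hS v
  obtain ⟨h, hh, hhv⟩ := hT v
  let β : k[X] →ₗ[k] k[X] →ₗ[k] V :=
    LinearMap.mk₂ k (fun a b ↦ aeval S a (aeval T b v)) (by simp) (by simp) (by simp) (by simp)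
  let W := Submodule.map₂ β (degreeLT k g.natDegree) (degreeLT k h.natDegree)
  have mem_W (a b : k[X]) : aeval S a (aeval T b v) ∈ W := by
    have aeval_mod {R : Module.End k V} {f : k[X]} (hf : aeval R f v = 0) (c : k[X]) :
        aeval R c v = aeval R (c % f) v := by
      conv_lhs => rw [← EuclideanDomain.mod_add_div c f]
      rw [map_add, LinearMap.add_apply, aeval_apply_eq_zero_of_dvd (dvd_mul_right f _) hf, add_zero]
    have comm (a b : k[X]) : aeval S a (aeval T b v) = aeval T b (aeval S a v) :=
      congr($((aeval_comp_eq_comp_aeval (aeval_comp_eq_comp_aeval hST.symm b).symm a)) v)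
    have mod_mem {f : k[X]} (hf : f ≠ 0) (c : k[X]) : c % f ∈ degreeLT k f.natDegree := by
      rw [mem_degreeLT, ← degree_eq_natDegree hf]
      exact EuclideanDomain.mod_lt c hf
    rw [aeval_mod hhv, comm, aeval_mod hgv, ← comm]
    exact Submodule.apply_mem_map₂ β (mod_mem hg a) (mod_mem hh b)
  refine ⟨W, ?_, by simpa using mem_W 1 1, Submodule.map₂_le.2 fun a _ b _ ↦ ?_,
    Submodule.map₂_le.2 fun a _ b _ ↦ ?_⟩
  · have (n : ℕ) : (degreeLT k n).FG :=
      Module.Finite.iff_fg.1 (.equiv (degreeLTEquiv k n).symm)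
    exact Module.Finite.iff_fg.2 ((this _).map₂ β (this _))
  · have h := mem_W (X * a) b
    rwa [map_mul, aeval_X] at h
  · have h := mem_W a (X * b)
    rw [map_mul, aeval_X] at h
    have comm := congr($(aeval_comp_eq_comp_aeval hST a) (aeval T b v))
    exact (congrArg (· ∈ W) comm).mp h

theorem IsLocallyAlgebraic.add_of_commute {S T : Module.End k V} (hS : IsLocallyAlgebraic S)
    (hT : IsLocallyAlgebraic T) (hST : Commute S T) : IsLocallyAlgebraic (S + T) := by
  intro v
  obtain ⟨W, _, hv, hWS, hWT⟩ := exists_finiteDimensional_mem_invtSubmodule hS hT hST v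
  obtain ⟨g, hg, hgv⟩ :=
    isLocallyAlgebraic_of_finiteDimensional (S.restrict hWS + T.restrict hWT) ⟨v, hv⟩
  refine ⟨g, hg, ?_⟩
  have h : (S + T) ∘ₗ W.subtype = W.subtype ∘ₗ (S.restrict hWS + T.restrict hWT) := rfl
  exact congr($(aeval_comp_eq_comp_aeval h g) ⟨v, hv⟩).trans congr(W.subtype $hgv)

variable [PerfectField k]

theorem exists_isNilpotentPartMod {g : k[X]} (hg : g ≠ 0) : ∃ n, IsNilpotentPartMod n g := by
  have : Module.Finite k (AdjoinRoot g) := (AdjoinRoot.powerBasis hg).finite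
  obtain ⟨N, hN, S, -, nilpotent, semisimple, h⟩ := Module.End.exists_isNilpotent_isSemisimple
    (f := Algebra.lmul k (AdjoinRoot g) (AdjoinRoot.root g))
  rw [Algebra.adjoin_singleton_eq_range_aeval] at hN
  obtain ⟨n, rfl⟩ := hN
  have h_lmul : aeval (Algebra.lmul k (AdjoinRoot g) (AdjoinRoot.root g)) n =
      Algebra.lmul k (AdjoinRoot g) (AdjoinRoot.mk g n) := by
    rw [aeval_algHom_apply, AdjoinRoot.aeval_eq]
  change aeval (Algebra.lmul k (AdjoinRoot g) (AdjoinRoot.root g)) n = _ at h_lmul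
  refine ⟨n, (isNilpotentPartMod_iff hg).2 ⟨h_lmul ▸ nilpotent, ?_⟩⟩
  convert semisimple
  rw [map_sub, map_sub, AdjoinRoot.mk_X, h, ← h_lmul]
  exact add_sub_cancel_left _ S

theorem IsNilpotentPartMod.dvd_sub {n n' g : k[X]} (hg : g ≠ 0) (h : IsNilpotentPartMod n g)
    (h' : IsNilpotentPartMod n' g) : g ∣ n - n' := by
  have : Module.Finite k (AdjoinRoot g) := (AdjoinRoot.powerBasis hg).finite
  rw [isNilpotentPartMod_iff hg] at h h'
  have comm (a b : AdjoinRoot g) : Commute (Algebra.lmul k _ a) (Algebra.lmul k _ b) :=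
    (Commute.all a b).map (Algebra.lmul k (AdjoinRoot g))
  have hn := (Module.End.isNilpotent_isSemisimple_unique h.1 h.2 h'.1 h'.2 (comm _ _) (comm _ _)
    (by simp only [← map_add, add_sub_cancel])).1
  rw [← AdjoinRoot.mk_eq_zero, map_sub, sub_eq_zero]
  exact Algebra.lmul_injective hn

theorem IsLocallyAlgebraic.exists_nilpotentPart {T : Module.End k V} (hT : IsLocallyAlgebraic T) :
    ∃ N : Module.End k V, ∀ (n g : k[X]) (v : V), g ≠ 0 → IsNilpotentPartMod n g →
      aeval T g v = 0 → N v = aeval T n v := by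
  choose g hg hgv using hT
  choose n hn using fun v ↦ exists_isNilpotentPartMod (hg v)
  have mono {n g f : k[X]} (h : f ∣ g) (hn : IsNilpotentPartMod n g) : IsNilpotentPartMod n f :=
    ⟨hn.1.imp fun _ ↦ h.trans, hn.2.imp fun _ ↦ .imp_right h.trans⟩
  have well_defined (n' g' : k[X]) (v : V) (hg' : g' ≠ 0) (hn' : IsNilpotentPartMod n' g')
      (hv : aeval T g' v = 0) : aeval T (n v) v = aeval T n' v := by
    obtain ⟨n'', hn''⟩ := exists_isNilpotentPartMod (mul_ne_zero (hg v) hg')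
    have aeval_eq {f p q : k[X]} (h : f ∣ p - q) (hf : aeval T f v = 0) :
        aeval T p v = aeval T q v := by
      have h := aeval_apply_eq_zero_of_dvd h hf
      rwa [map_sub, LinearMap.sub_apply, sub_eq_zero] at h
    rw [aeval_eq ((hn v).dvd_sub (hg v) (mono (dvd_mul_right _ _) hn'')) (hgv v),
      aeval_eq (hn'.dvd_sub hg' (mono (dvd_mul_left _ _) hn'')) hv]
  refine ⟨⟨⟨fun v ↦ aeval T (n v) v, fun v w ↦ ?_⟩, fun c v ↦ ?_⟩, well_defined⟩
  · have hg' := mul_ne_zero (hg v) (hg w)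
    obtain ⟨n', hn'⟩ := exists_isNilpotentPartMod hg'
    have hv := aeval_apply_eq_zero_of_dvd (dvd_mul_right (g v) (g w)) (hgv v)
    have hw := aeval_apply_eq_zero_of_dvd (dvd_mul_left (g w) (g v)) (hgv w)
    rw [well_defined n' _ v hg' hn' hv, well_defined n' _ w hg' hn' hw, ← map_add]
    exact well_defined n' _ _ hg' hn' (by rw [map_add, hv, hw, add_zero])
  · rw [RingHom.id_apply, ← map_smul]
    exact well_defined (n v) _ _ (hg v) (hn v) (by rw [map_smul, hgv, smul_zero])

/-- The nilpotent part of a locally algebraic operator in its Jordan decomposition. -/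
noncomputable def IsLocallyAlgebraic.nilpotentPart {T : Module.End k V}
    (hT : IsLocallyAlgebraic T) : Module.End k V :=
  hT.exists_nilpotentPart.choose

namespace IsLocallyAlgebraic

variable {T : Module.End k V} (hT : IsLocallyAlgebraic T)

include hT

theorem nilpotentPart_apply {n g : k[X]} {v : V} (hg : g ≠ 0) (hn : IsNilpotentPartMod n g)
    (hv : aeval T g v = 0) : hT.nilpotentPart v = aeval T n v :=
  hT.exists_nilpotentPart.choose_spec n g v hg hn hv

theorem nilpotentPart_comp {V' : Type*} [AddCommGroup V'] [Module k V'] {T' : Module.End k V'}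
    (hT' : IsLocallyAlgebraic T') {f : V →ₗ[k] V'} (h : T' ∘ₗ f = f ∘ₗ T) :
    hT'.nilpotentPart ∘ₗ f = f ∘ₗ hT.nilpotentPart := by
  ext v
  obtain ⟨g, hg, hgv⟩ := hT v
  obtain ⟨n, hn⟩ := exists_isNilpotentPartMod hg
  have aeval_apply (p : k[X]) : aeval T' p (f v) = f (aeval T p v) :=
    congr($(aeval_comp_eq_comp_aeval h p) v)
  rw [LinearMap.comp_apply, LinearMap.comp_apply, hT.nilpotentPart_apply hg hn hgv,
    hT'.nilpotentPart_apply hg hn (by rw [aeval_apply, hgv, map_zero]), aeval_apply]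

theorem nilpotentPart_locallyNilpotent (v : V) : ∃ m, (hT.nilpotentPart ^ m) v = 0 := by
  obtain ⟨g, hg, hgv⟩ := hT v
  obtain ⟨n, hn⟩ := exists_isNilpotentPartMod hg
  let orbit : k[X] →ₗ[k] V := LinearMap.applyₗ v ∘ₗ (aeval T).toLinearMap
  have comp_orbit : hT.nilpotentPart ∘ₗ orbit = orbit ∘ₗ Algebra.lmul k k[X] n := by
    refine LinearMap.ext fun f ↦ ?_
    have hf : aeval T g (aeval T f v) = 0 := by
      rw [← Module.End.mul_apply, ← map_mul]
      exact aeval_apply_eq_zero_of_dvd (dvd_mul_right _ _) hgv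
    refine (hT.nilpotentPart_apply hg hn hf).trans ?_
    rw [← Module.End.mul_apply, ← map_mul]
    rfl
  obtain ⟨m, hm⟩ := hn.1
  have h := congr($(comp_pow_eq_pow_comp comp_orbit m) 1)
  rw [← map_pow] at h
  refine ⟨m, ?_⟩
  simpa [orbit, aeval_apply_eq_zero_of_dvd hm hgv, -map_pow] using h

theorem nilpotentPart_eq_self (h : ∀ v, ∃ n, (T ^ n) v = 0) : hT.nilpotentPart = T := by
  ext v
  obtain ⟨m, hm⟩ := h v
  have hX : IsNilpotentPartMod (X : k[X]) (X ^ m) :=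
    ⟨⟨m, dvd_rfl⟩, X, irreducible_X.squarefree, by simp⟩
  rw [hT.nilpotentPart_apply (pow_ne_zero m X_ne_zero) hX (by rwa [map_pow, aeval_X]), aeval_X]

theorem commute_nilpotentPart {S : Module.End k V} (h : Commute T S) :
    Commute hT.nilpotentPart S :=
  hT.nilpotentPart_comp hT h

theorem isNilpotent_and_isSemisimple_sub_nilpotentPart [FiniteDimensional k V] :
    IsNilpotent hT.nilpotentPart ∧ (T - hT.nilpotentPart).IsSemisimple := by
  have hg := minpoly.ne_zero_of_finite k T
  obtain ⟨n, hn⟩ := exists_isNilpotentPartMod hg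
  have eq_aeval : hT.nilpotentPart = aeval T n :=
    LinearMap.ext fun v ↦ hT.nilpotentPart_apply hg hn (by simp)
  obtain ⟨⟨m, hm⟩, p, hp, hdvd⟩ := hn
  rw [eq_aeval]
  refine ⟨⟨m, ?_⟩, Module.End.isSemisimple_of_squarefree_aeval_eq_zero hp ?_⟩
  · rw [← map_pow, minpoly.dvd_iff.1 hm]
  · rw [← minpoly.dvd_iff.1 hdvd, aeval_comp, map_sub, aeval_X]

theorem nilpotentPart_add_of_finiteDimensional [FiniteDimensional k V] {S : Module.End k V}
    (hS : IsLocallyAlgebraic S) (hST : Commute S T) (hadd : IsLocallyAlgebraic (S + T)) :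
    hadd.nilpotentPart = hS.nilpotentPart + hT.nilpotentPart := by
  have hS_T := hS.commute_nilpotentPart hST
  have hT_S := hT.commute_nilpotentPart hST.symm
  have hS_hT := hS.commute_nilpotentPart hT_S.symm
  have hS_S := hS.commute_nilpotentPart (.refl S)
  have hT_T := hT.commute_nilpotentPart (.refl T)
  obtain ⟨nilpotentS, semisimpleS⟩ := hS.isNilpotent_and_isSemisimple_sub_nilpotentPart
  obtain ⟨nilpotentT, semisimpleT⟩ := hT.isNilpotent_and_isSemisimple_sub_nilpotentPart
  obtain ⟨nilpotent, semisimple⟩ := hadd.isNilpotent_and_isSemisimple_sub_nilpotentPart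
  have semisimple_add : (S - hS.nilpotentPart + (T - hT.nilpotentPart)).IsSemisimple :=
    semisimpleS.add_of_commute
      ((hST.sub_right hT_S.symm).sub_left (hS_T.sub_right hS_hT)) semisimpleT
  refine (Module.End.isNilpotent_isSemisimple_unique nilpotent semisimple
    (hS_hT.isNilpotent_add nilpotentS nilpotentT) semisimple_add ?_ ?_ ?_).1
  · exact (hadd.commute_nilpotentPart (.refl _)).sub_right (.refl _)
  · exact ((hS_S.sub_right (.refl _)).add_right (hS_T.sub_right hS_hT)).add_left
      ((hT_S.sub_right hS_hT.symm).add_right (hT_T.sub_right (.refl _)))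
  · abel

theorem nilpotentPart_add_of_commute {S : Module.End k V} (hS : IsLocallyAlgebraic S)
    (hST : Commute S T) : (hS.add_of_commute hT hST).nilpotentPart =
      hS.nilpotentPart + hT.nilpotentPart := by
  ext v
  obtain ⟨W, _, hv, hWS, hWT⟩ := exists_finiteDimensional_mem_invtSubmodule hS hT hST v
  have finite (R : Module.End k W) := isLocallyAlgebraic_of_finiteDimensional R
  have hW : Commute (S.restrict hWS) (T.restrict hWT) :=
    LinearMap.ext fun w ↦ Subtype.ext congr($hST w)
  have h := congr(W.subtype ($((finite _).nilpotentPart_add_of_finiteDimensional (finite _) hW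
    (finite _)) ⟨v, hv⟩))
  have apply_eq {R : Module.End k V} (hR : IsLocallyAlgebraic R) (hWR : W ∈ R.invtSubmodule) :
      W.subtype ((finite (R.restrict hWR)).nilpotentPart ⟨v, hv⟩) = hR.nilpotentPart v :=
    congr($((finite (R.restrict hWR)).nilpotentPart_comp hR (f := W.subtype) rfl) ⟨v, hv⟩).symm
  rw [LinearMap.add_apply, map_add, apply_eq hS, apply_eq hT] at h
  have hWST : W ∈ (S + T).invtSubmodule := fun w hw ↦ W.add_mem (hWS hw) (hWT hw)
  exact (apply_eq (hS.add_of_commute hT hST) hWST).symm.trans h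

end IsLocallyAlgebraic

end NilpotentPart

section TensorProduct

variable {k : Type*} [Field k] {V : Type*} [AddCommGroup V] [Module k V] {T : Module.End k V}

theorem IsLocallyAlgebraic.lTensor (hT : IsLocallyAlgebraic T) (U : Type*) [AddCommGroup U]
    [Module k U] : IsLocallyAlgebraic (V := U ⊗[k] V) (T.lTensor U) := by
  intro z
  induction z with
  | zero => exact ⟨1, one_ne_zero, map_zero _⟩
  | add z w hz hw => exact exists_ne_zero_aeval_add_apply_eq_zero hz hw
  | tmul u v =>
    obtain ⟨g, hg, hgv⟩ := hT v
    have h : T.lTensor U ∘ₗ TensorProduct.mk k U V u = TensorProduct.mk k U V u ∘ₗ T := rfl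
    refine ⟨g, hg, congr($(aeval_comp_eq_comp_aeval h g) v).trans ?_⟩
    rw [LinearMap.comp_apply, hgv, map_zero]

theorem IsLocallyAlgebraic.rTensor (hT : IsLocallyAlgebraic T) (U : Type*) [AddCommGroup U]
    [Module k U] : IsLocallyAlgebraic (V := V ⊗[k] U) (T.rTensor U) := by
  intro z
  induction z with
  | zero => exact ⟨1, one_ne_zero, map_zero _⟩
  | add z w hz hw => exact exists_ne_zero_aeval_add_apply_eq_zero hz hw
  | tmul v u =>
    obtain ⟨g, hg, hgv⟩ := hT v
    have h : T.rTensor U ∘ₗ (TensorProduct.mk k V U).flip u =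
        (TensorProduct.mk k V U).flip u ∘ₗ T := rfl
    refine ⟨g, hg, congr($(aeval_comp_eq_comp_aeval h g) v).trans ?_⟩
    rw [LinearMap.comp_apply, hgv, map_zero]

variable [PerfectField k]

theorem IsLocallyAlgebraic.nilpotentPart_lTensor (hT : IsLocallyAlgebraic T) (U : Type*)
    [AddCommGroup U] [Module k U] :
    (hT.lTensor U).nilpotentPart = hT.nilpotentPart.lTensor U :=
  TensorProduct.ext' fun u v ↦
    congr($(hT.nilpotentPart_comp (hT.lTensor U) (f := TensorProduct.mk k U V u) rfl) v)

theorem IsLocallyAlgebraic.nilpotentPart_rTensor (hT : IsLocallyAlgebraic T) (U : Type*)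
    [AddCommGroup U] [Module k U] :
    (hT.rTensor U).nilpotentPart = hT.nilpotentPart.rTensor U :=
  TensorProduct.ext' fun v u ↦
    congr($(hT.nilpotentPart_comp (hT.rTensor U) (f := (TensorProduct.mk k V U).flip u) rfl) v)

theorem IsLocallyAlgebraic.nilpotentPart_mul {A : Type*} [CommRing A] [Algebra k A]
    {T : Module.End k A} (hT : IsLocallyAlgebraic T)
    (leibniz : ∀ a b, T (a * b) = a • T b + b • T a) (a b : A) :
    hT.nilpotentPart (a * b) = a • hT.nilpotentPart b + b • hT.nilpotentPart a := by
  refine (leibniz_iff_comp_mul' _).2 ?_ a b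
  rw [← hT.nilpotentPart_rTensor, ← hT.nilpotentPart_lTensor,
    ← (hT.lTensor A).nilpotentPart_add_of_commute (hT.rTensor A) (commute_rTensor_lTensor T T)]
  exact IsLocallyAlgebraic.nilpotentPart_comp _ hT ((leibniz_iff_comp_mul' T).1 leibniz)

end TensorProduct

section Lift

open Coalgebra Polynomial

variable {k : Type*} [Field k]

theorem isLocallyAlgebraic_of_comul_comp {A : Type*} [AddCommGroup A] [Module k A] [Coalgebra k A]
    {T : Module.End k A} (hT : comul ∘ₗ T = T.lTensor A ∘ₗ comul) : IsLocallyAlgebraic T := by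
  intro a
  let r := ℛ k a
  let W : Submodule k A := Submodule.span k (r.left '' r.index)
  have pow_mem (n : ℕ) : (T ^ n) a ∈ W := by
    rw [eq_leftInvariantOp_of_comul_comp (comul_comp_pow hT n), leftInvariantOp_apply _ r]
    exact Submodule.sum_mem _ fun i hi ↦
      Submodule.smul_mem _ _ (Submodule.subset_span ⟨i, hi, rfl⟩)
  let orbit : k[X] →ₗ[k] A := LinearMap.applyₗ a ∘ₗ (aeval T).toLinearMap
  have orbit_mem (g : k[X]) : orbit g ∈ W := by
    change aeval T g a ∈ W
    rw [aeval_eq_sum_range, LinearMap.sum_apply]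
    exact Submodule.sum_mem _ fun n _ ↦ Submodule.smul_mem _ _ (pow_mem n)
  have : Module.Finite k W := Module.Finite.span_of_finite k (r.index.finite_toSet.image _)
  by_contra! h
  refine Polynomial.not_finite (R := k) (.of_injective (orbit.codRestrict W orbit_mem) ?_)
  rw [← LinearMap.ker_eq_bot, LinearMap.ker_codRestrict, LinearMap.ker_eq_bot']
  exact fun g hg ↦ by_contra fun hg₀ ↦ h g hg₀ hg

theorem comul_comp_nilpotentPart [PerfectField k] {A : Type*} [AddCommGroup A] [Module k A]
    [Coalgebra k A] {T : Module.End k A} (hT : comul ∘ₗ T = T.lTensor A ∘ₗ comul)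
    (hT' : IsLocallyAlgebraic T) :
    comul ∘ₗ hT'.nilpotentPart = hT'.nilpotentPart.lTensor A ∘ₗ comul := by
  rw [← hT'.nilpotentPart_lTensor]
  exact (hT'.nilpotentPart_comp (hT'.lTensor A) hT.symm).symm

theorem exists_bialgHom_comp_eq [CharZero k] {B D : Type*} [CommRing B] [HopfAlgebra k B]
    [CommRing D] [HopfAlgebra k D] {φ : D →ₐc[k] B} (hφ : Function.Injective φ)
    (lam : D →ₐc[k] k[X]) : ∃ mu : B →ₐc[k] k[X], mu.comp φ = lam := by
  obtain ⟨Y, hY, hYφ⟩ := (isTangentVector_velocity lam).exists_comp_bialgHom_eq hφ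
  have left_invariant := comul_comp_leftInvariantOp Y
  have algebraic := isLocallyAlgebraic_of_comul_comp left_invariant
  have nilpotent := leftInvariantOp_velocity_locallyNilpotent lam
  have nilpotentPart_comp : algebraic.nilpotentPart ∘ₗ (φ : D →ₗ[k] B) =
      (φ : D →ₗ[k] B) ∘ₗ leftInvariantOp (velocity lam) := by
    have algebraic' := isLocallyAlgebraic_of_locallyNilpotent nilpotent
    rw [algebraic'.nilpotentPart_comp algebraic, algebraic'.nilpotentPart_eq_self nilpotent]
    exact LinearMap.ext fun d ↦ hYφ ▸ (coalgHom_leftInvariantOp φ Y d).symm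
  let N : Derivation k B B :=
    .mk' algebraic.nilpotentPart (algebraic.nilpotentPart_mul hY.leftInvariantOp_mul)
  obtain ⟨mu, hmu⟩ := exists_bialgHom_factorial_smul_coeff_eq N
    algebraic.nilpotentPart_locallyNilpotent (comul_comp_nilpotentPart left_invariant algebraic)
  refine ⟨mu, BialgHom.ext fun d ↦ polynomial_eq_of_factorial_smul_coeff_eq fun n ↦ ?_⟩
  rw [← counit_leftInvariantOp_velocity_pow lam, BialgHom.comp_apply, hmu,
    ← CoalgHomClass.counit_comp_apply φ]
  exact congr(counit (R := k) ($(comp_pow_eq_pow_comp nilpotentPart_comp n) d))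

end Lift

section Quotient

open Coalgebra

variable {k : Type v} {B C D : Type u} [Field k] [CommRing B] [CommRing C] [CommRing D]
  [HopfAlgebra k B] [HopfAlgebra k C] [HopfAlgebra k D]

theorem IsQuotientBy.ker_pointsMap {φ : D →ₐc[k] B} {π : B →ₐc[k] C} (h : IsQuotientBy φ π)
    (hπ : Function.Surjective π) : (pointsMap φ k).ker = (pointsMap π k).range := by
  ext b
  have mem_ker_iff : b ∈ (pointsMap φ k).ker ↔
      RingHom.ker (Bialgebra.counitAlgHom k D) ≤
        (RingHom.ker b.ofConv).comap φ := by
    refine ⟨fun hb d hd ↦ ?_, fun h ↦ ?_⟩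
    · have hbd : b.ofConv (φ d) = algebraMap k k (counit d) := congr(($hb).ofConv d)
      exact hbd.trans ((congrArg _ hd).trans (map_zero _))
    · refine WithConv.ext (AlgHom.ext fun d ↦ sub_eq_zero.1 ?_)
      have hd := @h (d - algebraMap k D (counit d)) (by simp)
      rw [pointsMap_apply, Points.one_apply]
      simpa only [Ideal.mem_comap, RingHom.mem_ker, map_sub, AlgHomClass.commutes] using hd
  rw [mem_ker_iff, ← Ideal.map_le_iff_le_comap, ← h.ker_eq, MonoidHom.mem_range,
    exists_pointsMap_eq_iff hπ]
  rfl

theorem plus_mono {L M : Subgroup (Points k B k)} (h : L ≤ M) : plus L ≤ plus M :=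
  sSup_le_sSup fun _ hS ↦ ⟨hS.1, hS.2.trans h⟩

theorem plus_le_map_plus_comap [CharZero k] {φ : D →ₐc[k] B} (hφ : Function.Injective φ)
    (M : Subgroup (Points k D k)) :
    plus M ≤ (plus (M.comap (pointsMap φ k))).map (pointsMap φ k) := by
  rw [plus_eq_closure, plus_eq_closure, MonoidHom.map_closure]
  refine Subgroup.closure_mono ?_
  rintro _ ⟨lam, rfl, hlam⟩
  obtain ⟨mu, rfl⟩ := exists_bialgHom_comp_eq hφ lam
  exact ⟨_, ⟨mu, rfl, hlam⟩, rfl⟩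

end Quotient

end AlgGrp

theorem mainTheorem12_general {k : Type v} [Field k] [CharZero k] {A B C D : Type u} [CommRing A]
    [CommRing B] [CommRing C] [CommRing D] [HopfAlgebra k A] [HopfAlgebra k B] [HopfAlgebra k C]
    [HopfAlgebra k D] (ι : A →ₐc[k] B) {π : B →ₐc[k] C} (hπ : Function.Surjective π)
    {φ : D →ₐc[k] B} (hφ : AlgGrp.IsQuotientBy φ π) :
    (AlgGrp.plusPoints k B).map (AlgGrp.pointsMap ι k) ≤
        AlgGrp.plusPoints k A ⊓ (AlgGrp.pointsMap ι k).range ∧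
      AlgGrp.plusPoints k D ≤ (AlgGrp.plusPoints k B).map (AlgGrp.pointsMap φ k) ∧
      ∀ W : Subgroup (AlgGrp.Points k B k),
        (AlgGrp.pointsMap π k).range ≤ W →
        AlgGrp.plus W ≤ (AlgGrp.pointsMap π k).range →
        AlgGrp.plus (W.map (AlgGrp.pointsMap φ k)) = ⊥ := by
  refine ⟨le_inf ?_ (Subgroup.map_le_range _ _), AlgGrp.plus_le_map_plus_comap hφ.injective ⊤,
    fun W hNW hW ↦ ?_⟩
  · exact (AlgGrp.map_plus_le ι ⊤).trans (AlgGrp.plus_mono le_top)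
  · have ker_eq := hφ.ker_pointsMap hπ
    have h := AlgGrp.plus_le_map_plus_comap hφ.injective (W.map (AlgGrp.pointsMap φ k))
    rw [Subgroup.comap_map_eq_self (ker_eq.trans_le hNW)] at h
    exact eq_bot_iff.2 (h.trans ((Subgroup.map_eq_bot_iff _).2 (hW.trans_eq ker_eq.symm)).le)

theorem mainTheorem12
    -- a local field `k` of characteristic zero
    {k : Type v} [NontriviallyNormedField k] [LocallyCompactSpace k] [CharZero k]
    -- the coordinate rings of the groups `G`, `H`, `N` and `Q`
    {A B C D : Type u} [CommRing A] [CommRing B] [CommRing C] [CommRing D]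
    [HopfAlgebra k A] [HopfAlgebra k B] [HopfAlgebra k C] [HopfAlgebra k D]
    [Algebra.FiniteType k A] [Algebra.FiniteType k D]
    -- `H` is an algebraic subgroup of `G`
    (ι : A →ₐc[k] B) (hι : Function.Surjective ι)
    -- `N` is a normal algebraic subgroup of `H`
    (π : B →ₐc[k] C) (hπ : Function.Surjective π) (hN : AlgGrp.IsNormal π)
    -- `Q = H / N`
    (φ : D →ₐc[k] B) (hφ : AlgGrp.IsQuotientBy φ π) :
    (AlgGrp.plusPoints k B).map (AlgGrp.pointsMap ι k) ≤
        AlgGrp.plusPoints k A ⊓ (AlgGrp.pointsMap ι k).range ∧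
      AlgGrp.plusPoints k D ≤ (AlgGrp.plusPoints k B).map (AlgGrp.pointsMap φ k) ∧
      ∀ W : Subgroup (AlgGrp.Points k B k),
        (AlgGrp.pointsMap π k).range ≤ W →
        AlgGrp.plus W ≤ (AlgGrp.pointsMap π k).range →
        AlgGrp.plus (W.map (AlgGrp.pointsMap φ k)) = ⊥ :=
  mainTheorem12_general ι hπ hφ
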